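/- **Setting.** A principal with $m$ actions and an agent with $n$ actions play a stage game with utility matrices $U_1,U_2\in[0,1]^{m\times n}$ repeatedly. For a mixed strategy $x\in\Delta_m$ of the principal and an agent action $b$ write $U_i(x,b)=\sum_a x_aU_i(a,b)$; let $\mathrm{BR}(x)=\arg\max_b U_2(x,b)$ and $P_b=\{x\in\Delta_m: b\in\mathrm{BR}(x)\}$. For $\varepsilon,\delta>0$, a strategy $x\in\Delta_m$ is an $(\varepsilon,\delta)$-approximate local Stackelberg strategy if $$\max_{b'\in\mathrm{BR}(x')}U_1(x',b')\le \max_{b\in\mathrm{BR}(x)}U_1(x,b)+\varepsilon\delta\qquad\text{for all }x'\in\Delta_m\text{ with }\|x'-x\|_1\le\delta .$$ The same notions are used when $U_2$ is replaced by a perturbed matrix $U_2+W$. In round $t$ the principal plays $x^{(t)}\in\Delta_m$ and, simultaneously, the agent plays an action $y^{(t)}$ by *Fictitious Play*: $y^{(t)}\in\mathrm{BR}(\bar x^{(t-1)})$, where $\bar x^{(t-1)}=\frac1{t-1}\sum_{s<t}x^{(s)}$ (the first action may be any action). Choices among several best responses are made by a tie-breaking rule, which is an arbitrary function of the agent's own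 past actions and of the current set of best responses. A *randomized algorithm* of the principal has a random seed and knows $U_1$ but not $U_2$: its strategy in each round depends on the seed, $U_1$ and the agent's past actions $y^{(1)},\dots,y^{(t-1)}$; moreover it may, on the same information, halt once after some round (or before the first one) and report a strategy. The *number of iterations it needs to find* an $(\varepsilon,\delta)$-approximate local Stackelberg strategy is the smallest $t$ such that $\bar x^{(t)}$ (with $t\ge1$) is such a strategy, or the algorithm has halted after at most $t$ rounds and the strategy that it reported is such a strategy ($\infty$ if there is no such $t$). **Theorem (Lower Bound).** There are universal constants $C,\eta,c>0$ such that the following holds. Let $\varepsilon\in(0,1/3)$, $n\ge 1/\varepsilon^2$ and $m\ge 1/\varepsilon^5$. Then there is a probability distribution $D$ over games $(U_1,U_2)$, with $U_1,U_2\in[0,1]^{m\times n}$, such that for every perturbation matrix $W\in\mathbb R^{m\times n}$ with all entries in $[-\eta,\eta]$ (in particular for $W=0$), the following holds for the distribution over games $(U_1,U_2+W)$ with $(U_1,U_2)\sim D$: 1. In every game in the support, each nonempty best-response polytope $P_b$ of the agent utility $U_2+W$ contains a strategy $x$ with $x_a\ge c/m$ for all $a$ (that is, the distance-from-boundary assumption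 holds with $R_{\min}=c/m$). 2. For every $\delta\in(0,2]$, every tie-breaking rule of the Fictitious Play agent, and every randomized algorithm of the principal, the number of iterations that the algorithm needs to find an $(\varepsilon,\delta)$-approximate local Stackelberg strategy has expectation at least $e^{C/\varepsilon}$, where the expectation is over the game and over the seed of the algorithm. -/

import Mathlib

open scoped ENNReal Matrix

/-- A stage game with `m` principal actions and `n` agent actions; rows are the principal's
actions, columns the agent's, and all utilities lie in `[0, 1]`. -/
structure StageGame (m n : ℕ) where
  U₁ : Matrix (Fin m) (Fin n) ℝ
  U₂ : Matrix (Fin m) (Fin n) ℝ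
  U₁_mem : ∀ a b, U₁ a b ∈ Set.Icc (0 : ℝ) 1
  U₂_mem : ∀ a b, U₂ a b ∈ Set.Icc (0 : ℝ) 1

/-- The agent's pure best responses to `x`; `(x ᵥ* U₂) b` is the agent's expected utility from
the pure action `b` when the principal plays the mixed strategy `x`. -/
noncomputable def bestResponses {m n : ℕ} (U₂ : Matrix (Fin m) (Fin n) ℝ) (x : Fin m → ℝ) :
    Finset (Fin n) :=
  open scoped Classical in
  Finset.univ.filter fun b => ∀ b', (x ᵥ* U₂) b' ≤ (x ᵥ* U₂) b

/-- `sup_{y ∈ BR(x)} U₁(x, y)`: the principal's utility from `x` when the agent best responds. -/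
noncomputable def stackelbergUtility {m n : ℕ} (U₁ U₂ : Matrix (Fin m) (Fin n) ℝ)
    (x : Fin m → ℝ) : ℝ :=
  sSup ((x ᵥ* U₁) '' (bestResponses U₂ x : Set (Fin n)))

/-- `x` is an `(ε, δ)`-approximate local Stackelberg strategy. -/
def IsApproxLocalStackelberg {m n : ℕ} (U₁ U₂ : Matrix (Fin m) (Fin n) ℝ) (ε δ : ℝ)
    (x : Fin m → ℝ) : Prop :=
  x ∈ stdSimplex ℝ (Fin m) ∧
    ∀ x' ∈ stdSimplex ℝ (Fin m), ∑ a, |x' a - x a| ≤ δ →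
      stackelbergUtility U₁ U₂ x' ≤ stackelbergUtility U₁ U₂ x + ε * δ

/-- The best response polytope `P_b`. -/
def bestResponsePolytope {m n : ℕ} (U₂ : Matrix (Fin m) (Fin n) ℝ) (b : Fin n) :
    Set (Fin m → ℝ) :=
  {x | x ∈ stdSimplex ℝ (Fin m) ∧ b ∈ bestResponses U₂ x}

/-- Every (nonempty) best response polytope contains a strategy all of whose coordinates are at
least `R`. -/
def FarFromBoundary {m n : ℕ} (U₂ : Matrix (Fin m) (Fin n) ℝ) (R : ℝ) : Prop :=
  ∀ b, (bestResponsePolytope U₂ b).Nonempty → ∃ x ∈ bestResponsePolytope U₂ b, ∀ a, R ≤ x a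

/-- A tie-breaking rule of the agent: given the agent's own past actions (latest first) and the
set of current best responses, it selects one of the latter. -/
structure TieBreaking (n : ℕ) where
  choose : List (Fin n) → Finset (Fin n) → Fin n
  choose_mem : ∀ h S, S.Nonempty → choose h S ∈ S

/-- A randomized algorithm of the principal, with random seed `ω : Ω`. Its inputs are the
principal's own utility matrix and the list of the agent's past actions, latest first. (The
principal's own past strategies are determined by these data.) `play` is the strategy played in
the next round; `halts` tells whether the algorithm declares that it has found an equilibrium, and
`output` is the strategy it reports at that moment. -/
structure PrincipalAlgorithm (m n : ℕ) (Ω : Type*) [MeasurableSpace Ω] where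
  play : Ω → Matrix (Fin m) (Fin n) ℝ → List (Fin n) → stdSimplex ℝ (Fin m)
  halts : Ω → Matrix (Fin m) (Fin n) ℝ → List (Fin n) → Bool
  output : Ω → Matrix (Fin m) (Fin n) ℝ → List (Fin n) → stdSimplex ℝ (Fin m)
  measurable_play : ∀ U h, Measurable fun ω => play ω U h
  measurable_halts : ∀ U h, Measurable fun ω => halts ω U h
  measurable_output : ∀ U h, Measurable fun ω => output ω U h

/-- The sum of the strategies that the principal has played in the rounds recorded in the list of
agent actions (latest first), when she plays `x h` right after the history `h`. -/
def cumulativePlay {m n : ℕ} (x : List (Fin n) → stdSimplex ℝ (Fin m)) :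
    List (Fin n) → (Fin m → ℝ)
  | [] => 0
  | _ :: h => cumulativePlay x h + (x h : Fin m → ℝ)

/-- The principal's average strategy over the rounds recorded in `h`. Before the first round this
is the zero vector, to which every agent action is a best response, so that the agent's first
action is an arbitrary one. -/
noncomputable def averagePlay {m n : ℕ} (x : List (Fin n) → stdSimplex ℝ (Fin m))
    (h : List (Fin n)) : Fin m → ℝ :=
  (h.length : ℝ)⁻¹ • cumulativePlay x h

/-- The agent's actions in the first `t` rounds, latest first, when the agent runs fictitious
play: in each round the action is a best response to the principal's average past strategy. -/
noncomputable def fictitiousPlay {m n : ℕ} (U₂ : Matrix (Fin m) (Fin n) ℝ) (tie : TieBreaking n)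
    (x : List (Fin n) → stdSimplex ℝ (Fin m)) : ℕ → List (Fin n)
  | 0 => []
  | t + 1 =>
    let h := fictitiousPlay U₂ tie x t
    tie.choose h (bestResponses U₂ (averagePlay x h)) :: h

/-- After `t` rounds the principal has found an `(ε, δ)`-approximate local Stackelberg strategy:
either her average strategy after `t` rounds is one, or the algorithm halted (for the first time)
after some `s ≤ t` rounds and the strategy it reported then is one. -/
def FoundAfter {m n : ℕ} {Ω : Type*} [MeasurableSpace Ω] (U₁ U₂ : Matrix (Fin m) (Fin n) ℝ)
    (ε δ : ℝ) (tie : TieBreaking n) (alg : PrincipalAlgorithm m n Ω) (ω : Ω) (t : ℕ) : Prop :=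
  let h : ℕ → List (Fin n) := fictitiousPlay U₂ tie (alg.play ω U₁)
  IsApproxLocalStackelberg U₁ U₂ ε δ (averagePlay (alg.play ω U₁) (h t)) ∨
    ∃ s ≤ t, alg.halts ω U₁ (h s) = true ∧ (∀ r < s, alg.halts ω U₁ (h r) = false) ∧
      IsApproxLocalStackelberg U₁ U₂ ε δ (alg.output ω U₁ (h s))

/-- The number of rounds until an `(ε, δ)`-approximate local Stackelberg strategy is found, `∞` if
this never happens. -/
noncomputable def iterationsToFind {m n : ℕ} {Ω : Type*} [MeasurableSpace Ω]
    (U₁ U₂ : Matrix (Fin m) (Fin n) ℝ) (ε δ : ℝ) (tie : TieBreaking n)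
    (alg : PrincipalAlgorithm m n Ω) (ω : Ω) : ℝ≥0∞ :=
  ⨅ (t : ℕ) (_ : FoundAfter U₁ U₂ ε δ tie alg ω t), (t : ℝ≥0∞)

/-!
The hard games hide a path of `K ≈ 1 / (6 * ε)` levels with `9 * K` options each; the option `i j`
taken at each level `j < K` is drawn uniformly and independently. Level `j` of the path has a row
`r j` and a column `c j`, and there is a last column `c K` without a row.

The agent plays `c 0` by default. The action `c (j + 1)` attracts him when the principal's strategy
has enough mass on row `r j`. Within the best response polytope of `c j` the principal's utility
grows with the mass on row `r j`, at a rate exceeding `ε` per unit of `ℓ¹` distance, and it jumps by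
more than `2 * ε` where `c (j + 1)` takes over. Moving from any strategy straight to the vertex `r j`
one can only pass from the polytope of `c j` into that of `c (j + 1)`
(`level_or_succ_mem_bestResponses`), so that a local optimum exists only at the end of the path: it
needs mass on row `r (K - 1)` (`le_of_isApproxLocalStackelberg`). All comparisons between the agent's
actions have margins that survive the perturbation.

The principal's matrix does not depend on the path, and she learns the option of a level only from
the agent's playing its column, hence, beyond level `0`, only after her average has had mass at
least `κ` on the row of the previous level. Such visits are rare: a row first visited around time `t` has received total
mass `κ * t`, so each doubling of time has room for boundedly many visits (`card_visitedRows_le`).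
During `2 ^ L` rounds, with `L` a small multiple of `K`, she therefore visits fewer rows than the
path has, unless she guesses a row of a level not yet announced. A guess can be made only at the
cost of a visit, or in the report, and it is right with probability `1 / (9 * K)`.

To make the last argument precise, the agent is replaced by one who considers the levels only after
they are revealed (`stagedPlay`). Before level `j` is revealed, this play does not depend on the
option of level `j`, so that the probability of a correct guess is proportional to the number of
options tried (`card_mul_card_filter_mem`); without a correct guess the two agents play alike
(`fictitiousPlay_eq_stagedPlay`). Hence at least `5 / 9` of the paths survive `2 ^ L` rounds, for
each seed (`nine_mul_card_hasReached_le`). For `ε` close to `1 / 3` there is one level and `L = 0`;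
then the agent's first action carries no information, two rounds are needed on `5 / 9` of the paths,
and the expectation `10 / 9` still exceeds `1`.
-/

/-! ### Best responses -/

theorem mem_bestResponses {m n : ℕ} {U : Matrix (Fin m) (Fin n) ℝ} {x : Fin m → ℝ} {b : Fin n} :
    b ∈ bestResponses U x ↔ ∀ b', (x ᵥ* U) b' ≤ (x ᵥ* U) b := by
  simp [bestResponses]

theorem bestResponses_nonempty {m n : ℕ} [NeZero n] (U : Matrix (Fin m) (Fin n) ℝ)
    (x : Fin m → ℝ) : (bestResponses U x).Nonempty := by
  obtain ⟨b, -, hb⟩ := Finset.exists_max_image Finset.univ (x ᵥ* U) Finset.univ_nonempty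
  exact ⟨b, mem_bestResponses.2 fun b' => hb b' (Finset.mem_univ _)⟩

/-- Before the first round every action is a best response, whatever the utilities. -/
theorem bestResponses_zero {m n : ℕ} (U : Matrix (Fin m) (Fin n) ℝ) :
    bestResponses U 0 = Finset.univ := by
  ext b
  simp [mem_bestResponses]

/-- Columns that are strictly worse than a common column `b₀` do not influence the set of best
responses. -/
theorem bestResponses_eq_of_eqOn {m n : ℕ} {U V : Matrix (Fin m) (Fin n) ℝ} {x : Fin m → ℝ}
    (S : Set (Fin n)) (b₀ : Fin n) (hS : ∀ b ∈ S, (x ᵥ* U) b = (x ᵥ* V) b) (h₀ : b₀ ∈ S)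
    (hU : ∀ b ∉ S, (x ᵥ* U) b < (x ᵥ* U) b₀) (hV : ∀ b ∉ S, (x ᵥ* V) b < (x ᵥ* V) b₀) :
    bestResponses U x = bestResponses V x := by
  ext b
  simp only [mem_bestResponses]
  have e₀ := hS b₀ h₀
  constructor
  · intro h b'
    have hb : b ∈ S := by
      by_contra hb
      exact absurd (h b₀) (not_le.2 (hU b hb))
    by_cases hb' : b' ∈ S
    · rw [← hS b hb, ← hS b' hb']
      exact h b'
    · rw [← hS b hb]
      exact ((hV b' hb').trans_eq e₀.symm).le.trans (h b₀)
  · intro h b'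
    have hb : b ∈ S := by
      by_contra hb
      exact absurd (h b₀) (not_le.2 (hV b hb))
    by_cases hb' : b' ∈ S
    · rw [hS b hb, hS b' hb']
      exact h b'
    · rw [hS b hb]
      exact ((hU b' hb').trans_eq e₀).le.trans (h b₀)

theorem le_stackelbergUtility {m n : ℕ} {U₁ U₂ : Matrix (Fin m) (Fin n) ℝ} {x : Fin m → ℝ}
    {b : Fin n} (hb : b ∈ bestResponses U₂ x) : (x ᵥ* U₁) b ≤ stackelbergUtility U₁ U₂ x :=
  le_csSup ((Finset.finite_toSet _).image _).bddAbove ⟨b, hb, rfl⟩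

theorem exists_stackelbergUtility_eq {m n : ℕ} [NeZero n] (U₁ U₂ : Matrix (Fin m) (Fin n) ℝ)
    (x : Fin m → ℝ) : ∃ b ∈ bestResponses U₂ x, stackelbergUtility U₁ U₂ x = (x ᵥ* U₁) b := by
  have h : stackelbergUtility U₁ U₂ x ∈ (x ᵥ* U₁) '' (bestResponses U₂ x : Set (Fin n)) :=
    Set.Nonempty.csSup_mem (Set.Nonempty.image _ (bestResponses_nonempty U₂ x))
      ((Finset.finite_toSet _).image _)
  obtain ⟨b, hb, e⟩ := h
  exact ⟨b, hb, e.symm⟩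

theorem abs_vecMul_le {m n : ℕ} {W : Matrix (Fin m) (Fin n) ℝ} {η : ℝ} (hW : ∀ a b, |W a b| ≤ η)
    {x : Fin m → ℝ} (hx : x ∈ stdSimplex ℝ (Fin m)) (b : Fin n) : |(x ᵥ* W) b| ≤ η := by
  calc |(x ᵥ* W) b| = |∑ a, x a * W a b| := rfl
    _ ≤ ∑ a, |x a * W a b| := Finset.abs_sum_le_sum_abs _ _
    _ ≤ ∑ a, x a * η := Finset.sum_le_sum fun a _ => by
        rw [abs_mul, abs_of_nonneg (hx.1 a)]
        exact mul_le_mul_of_nonneg_left (hW a b) (hx.1 a)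
    _ = η := by rw [← Finset.sum_mul, hx.2, one_mul]

/-! ### The agent's utilities along a path -/

/-- The agent's utility, in row `a`, of the action of level `j ≤ K` on a path with rows `r`. Level
`0` is a default action of constant utility `2/5`. The action of level `j + 1` rewards row `r j`
and, at half that rate, row `r (j + 1)`, which exists unless `j + 1` is the last level `K`. -/
noncomputable def levelUtility {m : ℕ} (K : ℕ) (r : ℕ → Fin m) (a : Fin m) : ℕ → ℝ
  | 0 => 2 / 5
  | j + 1 => (if a = r j then 1 else 0) + if j + 1 < K ∧ a = r (j + 1) then 1 / 2 else 0

/-- The agent's expected utility from the action of level `j` against `x`. -/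
noncomputable def levelValue {m : ℕ} (K : ℕ) (r : ℕ → Fin m) (x : Fin m → ℝ) : ℕ → ℝ
  | 0 => 2 / 5
  | j + 1 => x (r j) + if j + 1 < K then 1 / 2 * x (r (j + 1)) else 0

/-- The agent's utilities when only the levels below `l` of the path with rows `r` and columns `c`
are present; all other columns vanish. -/
noncomputable def agentMatrix {m n : ℕ} (K : ℕ) (r : ℕ → Fin m) (c : ℕ → Fin n) (l : ℕ) :
    Matrix (Fin m) (Fin n) ℝ :=
  fun a b => ∑ j ∈ Finset.range l, if b = c j then levelUtility K r a j else 0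

theorem sum_mul_levelUtility {m : ℕ} (K : ℕ) (r : ℕ → Fin m) {x : Fin m → ℝ}
    (hx : x ∈ stdSimplex ℝ (Fin m)) (j : ℕ) :
    ∑ a, x a * levelUtility K r a j = levelValue K r x j := by
  cases j with
  | zero => simp only [levelUtility, levelValue, ← Finset.sum_mul, hx.2, one_mul]
  | succ j =>
    simp only [levelUtility, levelValue, mul_add, Finset.sum_add_distrib]
    by_cases h : j + 1 < K <;> simp [h, mul_comm]

theorem vecMul_agentMatrix_of_notMem {m n K l : ℕ} {r : ℕ → Fin m} {c : ℕ → Fin n} {b : Fin n}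
    (hb : ∀ j < l, b ≠ c j) (x : Fin m → ℝ) : (x ᵥ* agentMatrix K r c l) b = 0 := by
  change ∑ a, x a * agentMatrix K r c l a b = 0
  refine Finset.sum_eq_zero fun a _ => ?_
  rw [agentMatrix, Finset.sum_eq_zero, mul_zero]
  intro j hj
  rw [if_neg (hb j (Finset.mem_range.1 hj))]

theorem agentMatrix_apply_column {m n K l : ℕ} {r : ℕ → Fin m} {c : ℕ → Fin n}
    (hc : Set.InjOn c (Set.Iic K)) (hl : l ≤ K + 1) {j : ℕ} (hj : j < l) (a : Fin m) :
    agentMatrix K r c l a (c j) = levelUtility K r a j := by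
  rw [agentMatrix, Finset.sum_eq_single j]
  · simp
  · intro j' hj' hne
    rw [if_neg]
    intro e
    have := Finset.mem_range.1 hj'
    exact hne (hc (Set.mem_Iic.2 (by omega)) (Set.mem_Iic.2 (by omega)) e.symm)
  · intro h
    exact absurd (Finset.mem_range.2 hj) h

theorem vecMul_agentMatrix_column {m n K l : ℕ} {r : ℕ → Fin m} {c : ℕ → Fin n}
    (hc : Set.InjOn c (Set.Iic K)) (hl : l ≤ K + 1) {j : ℕ} (hj : j < l) {x : Fin m → ℝ}
    (hx : x ∈ stdSimplex ℝ (Fin m)) :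
    (x ᵥ* agentMatrix K r c l) (c j) = levelValue K r x j := by
  rw [← sum_mul_levelUtility K r hx]
  change ∑ a, x a * agentMatrix K r c l a (c j) = _
  refine Finset.sum_congr rfl fun a _ => ?_
  rw [agentMatrix_apply_column hc hl hj]

theorem levelUtility_mem_Icc {m K : ℕ} {r : ℕ → Fin m} (hr : Set.InjOn r (Set.Iio K)) {j : ℕ}
    (hj : j ≤ K) (a : Fin m) : levelUtility K r a j ∈ Set.Icc (0 : ℝ) 1 := by
  cases j with
  | zero => norm_num [levelUtility]
  | succ j =>
    simp only [levelUtility]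
    split_ifs with h₁ h₂
    · have := hr (Set.mem_Iio.2 (by omega)) (Set.mem_Iio.2 h₂.1) (h₁.symm.trans h₂.2)
      omega
    all_goals norm_num

theorem agentMatrix_mem_Icc {m n K : ℕ} {r : ℕ → Fin m} {c : ℕ → Fin n}
    (hr : Set.InjOn r (Set.Iio K)) (hc : Set.InjOn c (Set.Iic K)) (a : Fin m) (b : Fin n) :
    agentMatrix K r c (K + 1) a b ∈ Set.Icc (0 : ℝ) 1 := by
  by_cases h : ∃ j ≤ K, b = c j
  · obtain ⟨j, hj, rfl⟩ := h
    rw [agentMatrix_apply_column hc le_rfl (by omega)]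
    exact levelUtility_mem_Icc hr hj a
  · push Not at h
    rw [agentMatrix, Finset.sum_eq_zero]
    · simp
    · intro j hj
      rw [if_neg (h j (by have := Finset.mem_range.1 hj; omega))]

/-- An action whose value falls short of the default value `2 / 5` by more than `1 / 50` stays
strictly worse than the default action after a perturbation of size `1 / 100`. -/
theorem vecMul_lt_default_of_lt {m n K l : ℕ} {r : ℕ → Fin m} {c : ℕ → Fin n}
    (hc : Set.InjOn c (Set.Iic K)) (hl : l ≤ K + 1) (hl' : 0 < l)
    {W : Matrix (Fin m) (Fin n) ℝ} (hW : ∀ a b, |W a b| ≤ 1 / 100)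
    {x : Fin m → ℝ} (hx : x ∈ stdSimplex ℝ (Fin m)) {b : Fin n}
    (hb : (x ᵥ* agentMatrix K r c l) b < 19 / 50) :
    (x ᵥ* (agentMatrix K r c l + W)) b < (x ᵥ* (agentMatrix K r c l + W)) (c 0) := by
  simp only [Matrix.vecMul_add, Pi.add_apply]
  rw [vecMul_agentMatrix_column hc hl hl' hx, levelValue]
  have h₁ := abs_le.1 (abs_vecMul_le hW hx b)
  have h₂ := abs_le.1 (abs_vecMul_le hW hx (c 0))
  linarith [h₁.2, h₂.1]

theorem exists_level_of_mem_bestResponses {m n K : ℕ} {r : ℕ → Fin m} {c : ℕ → Fin n}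
    (hc : Set.InjOn c (Set.Iic K))
    {W : Matrix (Fin m) (Fin n) ℝ} (hW : ∀ a b, |W a b| ≤ 1 / 100)
    {x : Fin m → ℝ} (hx : x ∈ stdSimplex ℝ (Fin m)) {b : Fin n}
    (hb : b ∈ bestResponses (agentMatrix K r c (K + 1) + W) x) :
    ∃ j ≤ K, b = c j ∧ 19 / 50 ≤ levelValue K r x j := by
  have key : ¬ (x ᵥ* agentMatrix K r c (K + 1)) b < 19 / 50 := fun h =>
    absurd (mem_bestResponses.1 hb (c 0))
      (not_le.2 (vecMul_lt_default_of_lt hc le_rfl (by omega) hW hx h))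
  by_cases h : ∃ j ≤ K, b = c j
  · obtain ⟨j, hj, rfl⟩ := h
    refine ⟨j, hj, rfl, ?_⟩
    rwa [vecMul_agentMatrix_column hc le_rfl (by omega) hx, not_lt] at key
  · push Not at h
    rw [vecMul_agentMatrix_of_notMem fun j hj => h j (by omega)] at key
    norm_num at key

/-- The levels from `l` on can be removed without changing the best responses to `x`, if all of
them have small value at `x`. -/
theorem bestResponses_agentMatrix_eq {m n K l : ℕ} {r : ℕ → Fin m} {c : ℕ → Fin n}
    (hc : Set.InjOn c (Set.Iic K)) (hl : l ≤ K + 1) (hl' : 0 < l)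
    {W : Matrix (Fin m) (Fin n) ℝ} (hW : ∀ a b, |W a b| ≤ 1 / 100)
    {x : Fin m → ℝ} (hx : x ∈ stdSimplex ℝ (Fin m))
    (h : ∀ j ≤ K, l ≤ j → levelValue K r x j < 19 / 50) :
    bestResponses (agentMatrix K r c l + W) x =
      bestResponses (agentMatrix K r c (K + 1) + W) x := by
  refine bestResponses_eq_of_eqOn (c '' Set.Iio l) (c 0) ?_ ⟨0, hl', rfl⟩ ?_ ?_
  · rintro _ ⟨j, hj, rfl⟩
    have hj := Set.mem_Iio.1 hj
    simp only [Matrix.vecMul_add, Pi.add_apply]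
    rw [vecMul_agentMatrix_column hc hl hj hx,
      vecMul_agentMatrix_column hc le_rfl (by omega) hx]
  · intro b hb
    refine vecMul_lt_default_of_lt hc hl hl' hW hx ?_
    rw [vecMul_agentMatrix_of_notMem fun j hj e => hb ⟨j, hj, e.symm⟩]
    norm_num
  · intro b hb
    refine vecMul_lt_default_of_lt hc le_rfl (by omega) hW hx ?_
    by_cases hj : ∃ j ≤ K, b = c j
    · obtain ⟨j, hj, rfl⟩ := hj
      rw [vecMul_agentMatrix_column hc le_rfl (by omega) hx]
      refine h j hj ?_
      by_contra hlt
      exact hb ⟨j, not_le.1 hlt, rfl⟩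
    · push Not at hj
      rw [vecMul_agentMatrix_of_notMem fun j hj' => hj j (by omega)]
      norm_num

/-! ### Best response polytopes are fat -/

theorem single_add_uniform_mem {m : ℕ} (hm : 0 < m) (a₀ : Fin m) {p : ℝ} (hp₀ : 0 ≤ p)
    (hp₁ : p ≤ 1) :
    (fun a => p * (if a = a₀ then 1 else 0) + (1 - p) * (1 / m : ℝ)) ∈ stdSimplex ℝ (Fin m) := by
  have : (m : ℝ) ≠ 0 := by positivity
  refine ⟨fun a => ?_, ?_⟩
  · have : 0 ≤ 1 - p := by linarith
    positivity
  · rw [Finset.sum_add_distrib, ← Finset.mul_sum]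
    simp
    field_simp
    ring

theorem farFromBoundary_agentMatrix {m n K : ℕ} {r : ℕ → Fin m} {c : ℕ → Fin n}
    (hr : Set.InjOn r (Set.Iio K)) (hc : Set.InjOn c (Set.Iic K)) (hm : 9 ≤ m)
    {W : Matrix (Fin m) (Fin n) ℝ} (hW : ∀ a b, |W a b| ≤ 1 / 100) :
    FarFromBoundary (agentMatrix K r c (K + 1) + W) (1 / 10 / m) := by
  rintro b ⟨y, hy, hb⟩
  obtain ⟨j, hj, rfl, -⟩ := exists_level_of_mem_bestResponses hc hW hy hb
  have hm' : (9 : ℝ) ≤ m := by exact_mod_cast hm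
  have hinv : (1 / m : ℝ) ≤ 1 / 9 := one_div_le_one_div_of_le (by norm_num) hm'
  have hinv₀ : (0 : ℝ) < 1 / m := by positivity
  -- It suffices that level `j` beats all other levels by the margin `1/50` at a fat strategy.
  have key : ∀ x ∈ stdSimplex ℝ (Fin m), (∀ a, 1 / 10 / m ≤ x a) →
      1 / 50 ≤ levelValue K r x j →
      (∀ j' ≤ K, j' ≠ j → levelValue K r x j' + 1 / 50 ≤ levelValue K r x j) →
      ∃ x ∈ bestResponsePolytope (agentMatrix K r c (K + 1) + W) (c j),
        ∀ a, 1 / 10 / m ≤ x a := by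
    intro x hx hfat hpos hval
    refine ⟨x, ⟨hx, mem_bestResponses.2 fun b' => ?_⟩, hfat⟩
    simp only [Matrix.vecMul_add, Pi.add_apply]
    have h₁ := (abs_le.1 (abs_vecMul_le hW hx b')).2
    have h₂ := (abs_le.1 (abs_vecMul_le hW hx (c j))).1
    rw [vecMul_agentMatrix_column hc le_rfl (by omega) hx]
    by_cases h : ∃ j' ≤ K, b' = c j'
    · obtain ⟨j', hj', rfl⟩ := h
      rw [vecMul_agentMatrix_column hc le_rfl (by omega) hx]
      by_cases e : j' = j
      · rw [e]
      · linarith [hval j' hj' e]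
    · push Not at h
      rw [vecMul_agentMatrix_of_notMem fun j' hj' => h j' (by omega)]
      linarith
  cases j with
  | zero =>
    refine key (fun _ => 1 / m) ?_ ?_ ?_ ?_
    · refine ⟨fun _ => hinv₀.le, ?_⟩
      have : (m : ℝ) ≠ 0 := by positivity
      simp [this]
    · intro a
      rw [div_div, mul_comm, ← div_div]
      linarith
    · norm_num [levelValue]
    · intro j' _ hne
      obtain ⟨j', rfl⟩ := Nat.exists_eq_succ_of_ne_zero hne
      simp only [levelValue]
      split_ifs <;> linarith
  | succ j =>
    have hfat := single_add_uniform_mem (by omega : 0 < m) (r j) (p := 9 / 10)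
      (by norm_num) (by norm_num)
    refine key _ hfat ?_ ?_ ?_
    · intro a
      have : (0 : ℝ) ≤ (if a = r j then 1 else 0) := by positivity
      have e : (1 / 10 / m : ℝ) = 1 / 10 * (1 / m) := by ring
      rw [e]
      linarith
    · have h₀ := hfat.1
      simp only [levelValue]
      have : (0 : ℝ) ≤ if j + 1 < K then 1 / 2 * (9 / 10 * (if r (j + 1) = r j then 1 else 0) +
          (1 - 9 / 10) * (1 / (m : ℝ))) else 0 := by
        split_ifs <;> positivity
      simp only [if_true]
      linarith
    · intro j' hj' hne
      have hj₁ : (9 / 10 : ℝ) ≤ levelValue K r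
          (fun a => 9 / 10 * (if a = r j then 1 else 0) + (1 - 9 / 10) * (1 / (m : ℝ)))
          (j + 1) := by
        have : (0 : ℝ) ≤ if j + 1 < K then 1 / 2 * (9 / 10 * (if r (j + 1) = r j then 1 else 0) +
            (1 - 9 / 10) * (1 / (m : ℝ))) else 0 := by
          split_ifs <;> positivity
        simp only [levelValue, if_true]
        linarith
      refine le_trans ?_ hj₁
      cases j' with
      | zero => norm_num [levelValue]
      | succ j' =>
        have hne' : r j' ≠ r j := fun e => hne (by
          rw [hr (Set.mem_Iio.2 (by omega)) (Set.mem_Iio.2 (by omega)) e])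
        simp only [levelValue, if_neg hne']
        split_ifs <;> linarith

/-! ### Strategies without mass on the last row are not local optima -/

/-- Utility guaranteed to the principal when the agent plays the action of level `j`: it vanishes
at level `0`, equals `3 * ε` at level `1` and then grows by `6 * ε` per level. (The truncated
subtraction is deliberate.) -/
noncomputable def baseUtility (ε : ℝ) (j : ℕ) : ℝ := 3 * ε * ((2 * j - 1 : ℕ) : ℝ)

theorem baseUtility_zero (ε : ℝ) : baseUtility ε 0 = 0 := by simp [baseUtility]

theorem baseUtility_succ (ε : ℝ) (j : ℕ) : baseUtility ε (j + 1) = 3 * ε * (2 * j + 1) := by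
  rw [baseUtility, show 2 * (j + 1) - 1 = 2 * j + 1 by omega]
  push_cast
  ring

/-- `U₁` is a utility matrix of the principal that fits the path with rows `r` and columns `c`:
the action of level `j < K` guarantees `baseUtility ε j` and pays `11 / 5 * ε` per unit of mass
on row `r j`; the one of level `K` pays `baseUtility ε K`. -/
structure FitsPath {m n : ℕ} (ε : ℝ) (K : ℕ) (r : ℕ → Fin m) (c : ℕ → Fin n)
    (U₁ : Matrix (Fin m) (Fin n) ℝ) : Prop where
  inner : ∀ j < K, ∀ a, U₁ a (c j) = baseUtility ε j + if a = r j then 11 / 5 * ε else 0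
  last : ∀ a, U₁ a (c K) = baseUtility ε K

theorem FitsPath.vecMul_inner {m n K : ℕ} {ε : ℝ} {r : ℕ → Fin m} {c : ℕ → Fin n}
    {U₁ : Matrix (Fin m) (Fin n) ℝ} (h : FitsPath ε K r c U₁) {x : Fin m → ℝ}
    (hx : x ∈ stdSimplex ℝ (Fin m)) {j : ℕ} (hj : j < K) :
    (x ᵥ* U₁) (c j) = baseUtility ε j + 11 / 5 * ε * x (r j) := by
  change ∑ a, x a * U₁ a (c j) = _
  simp only [h.inner j hj, mul_add, Finset.sum_add_distrib, ← Finset.sum_mul, hx.2, one_mul]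
  simp [mul_comm]

theorem FitsPath.vecMul_last {m n K : ℕ} {ε : ℝ} {r : ℕ → Fin m} {c : ℕ → Fin n}
    {U₁ : Matrix (Fin m) (Fin n) ℝ} (h : FitsPath ε K r c U₁) {x : Fin m → ℝ}
    (hx : x ∈ stdSimplex ℝ (Fin m)) : (x ᵥ* U₁) (c K) = baseUtility ε K := by
  change ∑ a, x a * U₁ a (c K) = _
  simp only [h.last, ← Finset.sum_mul, hx.2, one_mul]

theorem FitsPath.baseUtility_le {m n K : ℕ} {ε : ℝ} (hε : 0 ≤ ε) {r : ℕ → Fin m} {c : ℕ → Fin n}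
    {U₁ : Matrix (Fin m) (Fin n) ℝ} (h : FitsPath ε K r c U₁) {x : Fin m → ℝ}
    (hx : x ∈ stdSimplex ℝ (Fin m)) {j : ℕ} (hj : j ≤ K) :
    baseUtility ε j ≤ (x ᵥ* U₁) (c j) := by
  rcases hj.lt_or_eq with hj | rfl
  · rw [h.vecMul_inner hx hj]
    have := hx.1 (r j)
    have : 0 ≤ 11 / 5 * ε * x (r j) := by positivity
    linarith
  · rw [h.vecMul_last hx]

theorem stdSimplex_le_one {m : ℕ} {x : Fin m → ℝ} (hx : x ∈ stdSimplex ℝ (Fin m)) (a : Fin m) :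
    x a ≤ 1 := by
  rw [← hx.2]
  exact Finset.single_le_sum (fun a _ => hx.1 a) (Finset.mem_univ a)

/-- The `ℓ¹` distance travelled when moving a fraction `t` of the way to a vertex. -/
theorem sum_abs_move {m : ℕ} {x : Fin m → ℝ} (hx : x ∈ stdSimplex ℝ (Fin m)) (a₀ : Fin m)
    {t : ℝ} (ht : 0 ≤ t) :
    ∑ a, |((1 - t) • x + t • (Pi.single a₀ 1 : Fin m → ℝ)) a - x a| = 2 * t * (1 - x a₀) := by
  have h : ∀ a, |((1 - t) • x + t • (Pi.single a₀ 1 : Fin m → ℝ)) a - x a| =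
      t * x a + if a = a₀ then t * (1 - 2 * x a₀) else 0 := by
    intro a
    have e : ((1 - t) • x + t • (Pi.single a₀ 1 : Fin m → ℝ)) a - x a =
        t * ((if a = a₀ then 1 else 0) - x a) := by
      simp only [Pi.add_apply, Pi.smul_apply, smul_eq_mul, Pi.single_apply]
      ring
    rw [e, abs_mul, abs_of_nonneg ht]
    split_ifs with ha
    · subst ha
      rw [abs_of_nonneg (by linarith [stdSimplex_le_one hx a])]
      ring
    · rw [zero_sub, abs_neg, abs_of_nonneg (hx.1 a), add_zero]
  simp only [h, Finset.sum_add_distrib, ← Finset.mul_sum, hx.2]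
  simp
  ring

theorem levelValue_single {m K : ℕ} {r : ℕ → Fin m} (hr : Set.InjOn r (Set.Iio K)) {j : ℕ}
    (hj : j < K) {j' : ℕ} (hj' : j' ≤ K) :
    levelValue K r (Pi.single (r j) 1) j' =
      if j' = 0 then 2 / 5 else if j' = j + 1 then 1 else if j' = j then 1 / 2 else 0 := by
  have hne : ∀ i < K, i ≠ j → r i ≠ r j := fun i hi h e => h (hr hi hj e)
  cases j' with
  | zero => simp [levelValue]
  | succ i =>
    simp only [levelValue, Pi.single_apply]
    by_cases h₁ : i = j
    · subst h₁
      by_cases h₂ : i + 1 < K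
      · simp [hne (i + 1) h₂ (by omega)]
      · simp [h₂]
    · by_cases h₂ : i + 1 = j
      · subst h₂
        simp [hne i (by omega) h₁, hj]
      · by_cases h₃ : i + 1 < K
        · simp [hne i (by omega) h₁, hne (i + 1) h₃ h₂, h₁, h₂]
        · simp [hne i (by omega) h₁, h₁, h₂, h₃]

/-- The geometric heart of the construction: on the way from a point of the best response polytope
of level `j < K` to the vertex `r j`, only level `j + 1` can take over from level `j`, and it has
done so at the vertex. -/
theorem level_or_succ_mem_bestResponses {m n K : ℕ} {r : ℕ → Fin m} {c : ℕ → Fin n}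
    (hr : Set.InjOn r (Set.Iio K)) (hc : Set.InjOn c (Set.Iic K))
    {W : Matrix (Fin m) (Fin n) ℝ} (hW : ∀ a b, |W a b| ≤ 1 / 100)
    {x : Fin m → ℝ} {j : ℕ} (hj : j < K)
    (hb : c j ∈ bestResponses (agentMatrix K r c (K + 1) + W) x) {t : ℝ}
    (ht₀ : 0 ≤ t) (ht₁ : t ≤ 1) :
    c (j + 1) ∈ bestResponses (agentMatrix K r c (K + 1) + W)
        ((1 - t) • x + t • (Pi.single (r j) 1 : Fin m → ℝ)) ∨
      t < 1 ∧ c j ∈ bestResponses (agentMatrix K r c (K + 1) + W)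
        ((1 - t) • x + t • (Pi.single (r j) 1 : Fin m → ℝ)) := by
  set A := agentMatrix K r c (K + 1) + W with hA
  set e : Fin m → ℝ := Pi.single (r j) 1 with he
  have hes : e ∈ stdSimplex ℝ (Fin m) := single_mem_stdSimplex ℝ (r j)
  have hval : ∀ j' ≤ K, |(e ᵥ* A) (c j') - if j' = 0 then 2 / 5 else if j' = j + 1 then 1 else
      if j' = j then 1 / 2 else 0| ≤ 1 / 100 := by
    intro j' hj'
    rw [← levelValue_single hr hj hj', hA, Matrix.vecMul_add, Pi.add_apply,
      vecMul_agentMatrix_column hc le_rfl (by omega) hes, add_sub_cancel_left]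
    exact abs_vecMul_le hW hes _
  have hother : ∀ b, (∀ j' ≤ K, b ≠ c j') → |(e ᵥ* A) b| ≤ 1 / 100 := by
    intro b h
    rw [hA, Matrix.vecMul_add, Pi.add_apply,
      vecMul_agentMatrix_of_notMem fun j' hj' => h j' (by omega), zero_add]
    exact abs_vecMul_le hW hes _
  have hjs : j ≠ j + 1 := Nat.ne_of_lt j.lt_succ_self
  have hj₁ := abs_le.1 (hval j hj.le)
  have hj₂ := abs_le.1 (hval (j + 1) hj)
  simp only [Nat.succ_ne_zero, if_false, if_true] at hj₂
  have hlow : 39 / 100 ≤ (e ᵥ* A) (c j) := by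
    by_cases h : j = 0
    · simp only [h, if_true] at hj₁
      rw [h]
      linarith [hj₁.1]
    · simp only [h, if_false, if_true, hjs] at hj₁
      linarith [hj₁.1]
  have hup : (e ᵥ* A) (c j) ≤ 51 / 100 := by
    by_cases h : j = 0
    · simp only [h, if_true] at hj₁
      rw [h]
      linarith [hj₁.2]
    · simp only [h, if_false, if_true, hjs] at hj₁
      linarith [hj₁.2]
  have hrest : ∀ b, b ≠ c (j + 1) → (e ᵥ* A) b ≤ (e ᵥ* A) (c j) := by
    intro b hne
    by_cases h : ∃ j' ≤ K, b = c j'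
    · obtain ⟨j', hj', rfl⟩ := h
      have hne' : j' ≠ j + 1 := fun h => hne (by rw [h])
      by_cases hjj : j' = j
      · rw [hjj]
      have h' := abs_le.1 (hval j' hj')
      simp only [hne', hjj, if_false] at h'
      by_cases h₀ : j' = 0
      · have hj0 : j ≠ 0 := fun h => hjj (by omega)
        simp only [h₀, if_true] at h'
        simp only [hj0, if_false, if_true, hjs] at hj₁
        rw [h₀]
        linarith [h'.2, hj₁.1]
      · simp only [h₀, if_false] at h'
        linarith [h'.2]
    · push Not at h
      linarith [(abs_le.1 (hother b h)).2]
  have hcomb : ∀ b, (((1 - t) • x + t • e) ᵥ* A) b = (1 - t) * (x ᵥ* A) b + t * (e ᵥ* A) b := by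
    intro b
    simp [Matrix.add_vecMul, Matrix.smul_vecMul]
  have hx := mem_bestResponses.1 hb
  have hle : ∀ b, b ≠ c (j + 1) →
      (((1 - t) • x + t • e) ᵥ* A) b ≤ (((1 - t) • x + t • e) ᵥ* A) (c j) := by
    intro b hne
    rw [hcomb, hcomb]
    exact add_le_add (mul_le_mul_of_nonneg_left (hx b) (by linarith))
      (mul_le_mul_of_nonneg_left (hrest b hne) ht₀)
  by_cases hcmp : (((1 - t) • x + t • e) ᵥ* A) (c j) ≤
      (((1 - t) • x + t • e) ᵥ* A) (c (j + 1))
  · left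
    refine mem_bestResponses.2 fun b => ?_
    by_cases hb' : b = c (j + 1)
    · rw [hb']
    · exact (hle b hb').trans hcmp
  · right
    refine ⟨lt_of_le_of_ne ht₁ ?_, mem_bestResponses.2 fun b => ?_⟩
    · rintro rfl
      apply hcmp
      rw [hcomb, hcomb]
      linarith [hj₂.1]
    · by_cases hb' : b = c (j + 1)
      · rw [hb']
        exact (not_le.1 hcmp).le
      · exact hle b hb'

/-- An approximate local Stackelberg strategy puts mass on the last row of the path: everywhere
else the principal gains by moving towards the row announced by the agent's response, at rate
`11 / 10 * ε > ε` within the current polytope, and by more than `2 * ε` on entering the next. -/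
theorem le_of_isApproxLocalStackelberg {m n K : ℕ} [NeZero n] {ε δ : ℝ} {r : ℕ → Fin m}
    {c : ℕ → Fin n} {U₁ W : Matrix (Fin m) (Fin n) ℝ} {x : Fin m → ℝ}
    (hε : 0 < ε) (hδ : δ ∈ Set.Ioc (0 : ℝ) 2)
    (hK : 0 < K) (hr : Set.InjOn r (Set.Iio K)) (hc : Set.InjOn c (Set.Iic K))
    (hU : FitsPath ε K r c U₁) (hW : ∀ a b, |W a b| ≤ 1 / 100)
    (h : IsApproxLocalStackelberg U₁ (agentMatrix K r c (K + 1) + W) ε δ x) :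
    19 / 50 ≤ x (r (K - 1)) := by
  by_contra hlt
  obtain ⟨hx, hloc⟩ := h
  obtain ⟨b, hb, hval⟩ := exists_stackelbergUtility_eq U₁ (agentMatrix K r c (K + 1) + W) x
  obtain ⟨j, hj, rfl, hjv⟩ := exists_level_of_mem_bestResponses hc hW hx hb
  have hjK : j < K := by
    refine lt_of_le_of_ne hj ?_
    rintro rfl
    obtain ⟨i, rfl⟩ := Nat.exists_eq_succ_of_ne_zero hK.ne'
    simp [levelValue] at hjv
    exact hlt (by simpa using hjv)
  rw [hU.vecMul_inner hx hjK] at hval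
  have hv₀ := hx.1 (r j)
  have hv₁ := stdSimplex_le_one hx (r j)
  -- entering the polytope of level `j + 1` gains more than `2 * ε`
  have hjump : baseUtility ε j + 11 / 5 * ε * x (r j) + 2 * ε < baseUtility ε (j + 1) := by
    rcases Nat.eq_zero_or_pos j with h0 | h0
    · subst h0
      have h₁ := mem_bestResponses.1 hb (c 1)
      simp only [Matrix.vecMul_add, Pi.add_apply] at h₁
      rw [vecMul_agentMatrix_column hc le_rfl (by omega) hx,
        vecMul_agentMatrix_column hc le_rfl (by omega) hx] at h₁
      have w₁ := (abs_le.1 (abs_vecMul_le hW hx (c 1))).1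
      have w₀ := (abs_le.1 (abs_vecMul_le hW hx (c 0))).2
      have hpos : (0 : ℝ) ≤ if 0 + 1 < K then 1 / 2 * x (r (0 + 1)) else 0 := by
        have := hx.1 (r (0 + 1))
        split_ifs <;> positivity
      simp only [levelValue] at h₁
      -- row `r 0` carries little mass in the default polytope, so a jump of `3 * ε` is enough
      have hθ : x (r 0) ≤ 21 / 50 := by linarith
      rw [baseUtility_zero, baseUtility_succ]
      push_cast
      nlinarith
    · obtain ⟨i, rfl⟩ := Nat.exists_eq_succ_of_ne_zero h0.ne'
      rw [baseUtility_succ, Nat.succ_eq_add_one, baseUtility_succ]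
      push_cast
      nlinarith
  have hmove : ∀ t : ℝ, 0 ≤ t → t ≤ 1 → 2 * t * (1 - x (r j)) ≤ δ →
      (t < 1 → 2 * t * (1 - x (r j)) = δ) → False := by
    intro t ht₀ ht₁ hdist hdist'
    set x' := (1 - t) • x + t • (Pi.single (r j) 1 : Fin m → ℝ) with hx'
    have hx's : x' ∈ stdSimplex ℝ (Fin m) :=
      convex_stdSimplex ℝ (Fin m) hx (single_mem_stdSimplex ℝ (r j)) (by linarith) ht₀ (by ring)
    have hgain := hloc x' hx's ((sum_abs_move hx (r j) ht₀).trans_le hdist)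
    rw [hval] at hgain
    have hεδ : ε * δ ≤ 2 * ε := by nlinarith [hδ.2]
    rcases level_or_succ_mem_bestResponses hr hc hW hjK hb ht₀ ht₁ with hb' | ⟨ht, hb'⟩
    · have := (hU.baseUtility_le hε.le hx's hjK).trans (le_stackelbergUtility hb')
      linarith
    · have hle := le_stackelbergUtility (U₁ := U₁) hb'
      rw [hU.vecMul_inner hx's hjK] at hle
      have e : x' (r j) = x (r j) + t * (1 - x (r j)) := by
        simp [hx']
        ring
      rw [e] at hle
      have := hdist' ht
      have hpos : 0 < ε * δ := mul_pos hε hδ.1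
      have e' : 11 / 5 * ε * (x (r j) + t * (1 - x (r j))) =
          11 / 5 * ε * x (r j) + 11 / 10 * (ε * δ) := by
        rw [← this]
        ring
      linarith
  rcases le_or_gt (2 * (1 - x (r j))) δ with hd | hd
  · exact hmove 1 zero_le_one le_rfl (by linarith) fun h => absurd h (lt_irrefl _)
  · have hd₀ : 0 < 2 * (1 - x (r j)) := hδ.1.trans hd
    have e : 2 * (δ / (2 * (1 - x (r j)))) * (1 - x (r j)) = δ := by
      rw [mul_right_comm]
      exact mul_div_cancel₀ _ hd₀.ne'
    refine hmove (δ / (2 * (1 - x (r j)))) (div_nonneg hδ.1.le hd₀.le)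
      ((div_le_one hd₀).2 hd.le) e.le fun _ => e

/-! ### Averages move slowly -/

theorem cumulativePlay_nonneg {m n : ℕ} (x : List (Fin n) → stdSimplex ℝ (Fin m))
    (h : List (Fin n)) (a : Fin m) : 0 ≤ cumulativePlay x h a := by
  induction h with
  | nil => exact le_rfl
  | cons y h ih => exact add_nonneg ih ((x h).2.1 a)

theorem sum_cumulativePlay {m n : ℕ} (x : List (Fin n) → stdSimplex ℝ (Fin m))
    (h : List (Fin n)) : ∑ a, cumulativePlay x h a = h.length := by
  induction h with
  | nil => simp [cumulativePlay]
  | cons y h ih =>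
    simp only [cumulativePlay, Pi.add_apply, Finset.sum_add_distrib, ih, List.length_cons]
    have e : ∑ a, (x h) a = 1 := (x h).2.2
    rw [e]
    push_cast
    ring

theorem averagePlay_nil {m n : ℕ} (x : List (Fin n) → stdSimplex ℝ (Fin m)) :
    averagePlay x [] = 0 := by
  simp [averagePlay, cumulativePlay]

theorem averagePlay_mem {m n : ℕ} (x : List (Fin n) → stdSimplex ℝ (Fin m)) {h : List (Fin n)}
    (hh : h ≠ []) : averagePlay x h ∈ stdSimplex ℝ (Fin m) := by
  have hpos : (0 : ℝ) < h.length := by exact_mod_cast List.length_pos_iff.2 hh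
  refine ⟨fun a => mul_nonneg (inv_nonneg.2 hpos.le) (cumulativePlay_nonneg x h a), ?_⟩
  simp only [averagePlay, Pi.smul_apply, smul_eq_mul, ← Finset.mul_sum, sum_cumulativePlay]
  exact inv_mul_cancel₀ hpos.ne'

theorem le_averagePlay_iff {m n : ℕ} (x : List (Fin n) → stdSimplex ℝ (Fin m)) {h : List (Fin n)}
    (hh : 0 < h.length) {κ : ℝ} {a : Fin m} :
    κ ≤ averagePlay x h a ↔ κ * h.length ≤ cumulativePlay x h a := by
  have hpos : (0 : ℝ) < h.length := by exact_mod_cast hh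
  rw [averagePlay, Pi.smul_apply, smul_eq_mul, inv_mul_eq_div, le_div_iff₀ hpos]

theorem card_filter_le_mul_le_sum {ι : Type*} [Fintype ι] {y : ι → ℝ} (hy : ∀ a, 0 ≤ y a) (κ : ℝ) :
    (Finset.univ.filter fun a => κ ≤ y a).card * κ ≤ ∑ a, y a := by
  calc ((Finset.univ.filter fun a => κ ≤ y a).card : ℝ) * κ
      = ∑ a ∈ Finset.univ.filter fun a => κ ≤ y a, κ := by simp
    _ ≤ ∑ a ∈ Finset.univ.filter fun a => κ ≤ y a, y a :=
        Finset.sum_le_sum fun a ha => (Finset.mem_filter.1 ha).2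
    _ ≤ ∑ a, y a := Finset.sum_le_sum_of_subset_of_nonneg (Finset.filter_subset _ _)
        fun a _ _ => hy a

theorem card_filter_le_of_sum_le_one {ι : Type*} [Fintype ι] {y : ι → ℝ} (hy : ∀ a, 0 ≤ y a)
    (hy' : ∑ a, y a ≤ 1) {κ : ℝ} (hκ : 0 < κ) {q : ℕ} (hq : 1 < (q + 1) * κ) :
    (Finset.univ.filter fun a => κ ≤ y a).card ≤ q := by
  have h := (card_filter_le_mul_le_sum hy κ).trans hy'
  by_contra hlt
  have : (q : ℝ) + 1 ≤ (Finset.univ.filter fun a => κ ≤ y a).card := by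
    exact_mod_cast not_le.1 hlt
  nlinarith

/-- A growing sequence of records of the agent's actions, one action per round. -/
structure IsHistory {n : ℕ} (H : ℕ → List (Fin n)) : Prop where
  zero : H 0 = []
  succ : ∀ t, ∃ y, H (t + 1) = y :: H t

theorem IsHistory.length {n : ℕ} {H : ℕ → List (Fin n)} (hH : IsHistory H) (t : ℕ) :
    (H t).length = t := by
  induction t with
  | zero => simp [hH.zero]
  | succ t ih =>
    obtain ⟨y, e⟩ := hH.succ t
    simp [e, ih]

theorem IsHistory.ne_nil {n : ℕ} {H : ℕ → List (Fin n)} (hH : IsHistory H) {t : ℕ} (ht : 0 < t) :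
    H t ≠ [] := by
  intro e
  have := hH.length t
  simp [e] at this
  omega

theorem IsHistory.cumulativePlay_mono {m n : ℕ} {H : ℕ → List (Fin n)} (hH : IsHistory H)
    (x : List (Fin n) → stdSimplex ℝ (Fin m)) (a : Fin m) :
    Monotone fun t => cumulativePlay x (H t) a := by
  refine monotone_nat_of_le_succ fun t => ?_
  obtain ⟨y, e⟩ := hH.succ t
  simp only [e, cumulativePlay, Pi.add_apply]
  exact le_add_of_nonneg_right ((x (H t)).2.1 a)

/-- The rows that carry mass at least `κ` in one of the averages of the first `T` rounds. -/
noncomputable def visitedRows {m n : ℕ} (x : List (Fin n) → stdSimplex ℝ (Fin m)) (κ : ℝ)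
    (H : ℕ → List (Fin n)) (T : ℕ) : Finset (Fin m) :=
  open scoped Classical in
  Finset.univ.filter fun a => ∃ t ≤ T, κ ≤ averagePlay x (H t) a

/-- Only logarithmically many rows are visited: a row visited in the rounds `(2 ^ L, 2 ^ (L + 1)]`
must have received total mass `κ * 2 ^ L`, so each doubling of time has room for at most `2 / κ`
of them. -/
theorem card_visitedRows_le {m n : ℕ} (x : List (Fin n) → stdSimplex ℝ (Fin m)) {κ : ℝ}
    (hκ : 1 / 4 ≤ κ) {q : ℕ} (hq : 1 < (q + 1) * κ) {H : ℕ → List (Fin n)} (hH : IsHistory H)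
    (L : ℕ) : (visitedRows x κ H (2 ^ L)).card ≤ q + 8 * L := by
  classical
  have hκ₀ : 0 < κ := by linarith
  have hzero : ∀ a, ¬ κ ≤ averagePlay x (H 0) a := by
    intro a
    rw [hH.zero, averagePlay_nil, not_le]
    exact hκ₀
  induction L with
  | zero =>
    have hmem := averagePlay_mem x (hH.ne_nil one_pos)
    refine le_trans (Finset.card_le_card ?_)
      (card_filter_le_of_sum_le_one hmem.1 hmem.2.le hκ₀ hq)
    intro a ha
    obtain ⟨t, ht, h⟩ := (Finset.mem_filter.1 ha).2
    refine Finset.mem_filter.2 ⟨Finset.mem_univ _, ?_⟩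
    rcases Nat.eq_zero_or_pos t with rfl | h0
    · exact absurd h (hzero a)
    · rwa [show t = 1 by simp at ht; omega] at h
  | succ L ih =>
    set F := Finset.univ.filter fun a => κ * 2 ^ L ≤ cumulativePlay x (H (2 ^ (L + 1))) a with hF
    have hsub : visitedRows x κ H (2 ^ (L + 1)) ⊆ visitedRows x κ H (2 ^ L) ∪ F := by
      intro a ha
      obtain ⟨t, ht, h⟩ := (Finset.mem_filter.1 ha).2
      by_cases hle : t ≤ 2 ^ L
      · exact Finset.mem_union_left _ (Finset.mem_filter.2 ⟨Finset.mem_univ _, t, hle, h⟩)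
      · refine Finset.mem_union_right _ (Finset.mem_filter.2 ⟨Finset.mem_univ _, ?_⟩)
        have h2 : (0 : ℕ) < 2 ^ L := by positivity
        rw [le_averagePlay_iff x (by rw [hH.length]; omega), hH.length] at h
        have hlt : ((2 ^ L : ℕ) : ℝ) ≤ t := by exact_mod_cast (not_le.1 hle).le
        push_cast at hlt
        exact (mul_le_mul_of_nonneg_left hlt hκ₀.le).trans
          (h.trans (hH.cumulativePlay_mono x a ht))
    have hFcard : F.card ≤ 8 := by
      have h := card_filter_le_mul_le_sum (cumulativePlay_nonneg x (H (2 ^ (L + 1)))) (κ * 2 ^ L)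
      rw [sum_cumulativePlay, hH.length, ← hF] at h
      push_cast at h
      have hp : (0 : ℝ) < 2 ^ L := by positivity
      have h' : (F.card : ℝ) * κ ≤ 2 := by
        rw [pow_succ] at h
        nlinarith
      have : (F.card : ℝ) ≤ 8 := by nlinarith [(Nat.cast_nonneg F.card : (0 : ℝ) ≤ F.card)]
      exact_mod_cast this
    calc (visitedRows x κ H (2 ^ (L + 1))).card
        ≤ (visitedRows x κ H (2 ^ L) ∪ F).card := Finset.card_le_card hsub
      _ ≤ (visitedRows x κ H (2 ^ L)).card + F.card := Finset.card_union_le _ _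
      _ ≤ q + 8 * (L + 1) := by omega

/-! ### A staged agent that reveals the path level by level -/

/-- The number of revealed levels after the history `h`, if `l` levels had been revealed before:
level `0` is revealed once an average exists, level `l + 1` once that average has mass `κ` on row
`r l` of level `l`. -/
noncomputable def nextStage {m n : ℕ} (κ : ℝ) (x : List (Fin n) → stdSimplex ℝ (Fin m))
    (r : ℕ → Fin m) (h : List (Fin n)) : ℕ → ℕ
  | 0 => if h = [] then 0 else 1
  | l + 1 => if κ ≤ averagePlay x h (r l) then l + 2 else l + 1

/-- Fictitious play of an agent who considers the levels of the path only from the moment they are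
revealed. The second component is the number of levels revealed so far, so that the play in a
round depends on the revealed levels only. -/
noncomputable def stagedPlay {m n : ℕ} (κ : ℝ) (K : ℕ) (W : Matrix (Fin m) (Fin n) ℝ)
    (tie : TieBreaking n) (x : List (Fin n) → stdSimplex ℝ (Fin m)) (r : ℕ → Fin m)
    (c : ℕ → Fin n) : ℕ → List (Fin n) × ℕ
  | 0 => ([], 0)
  | t + 1 =>
    let p := stagedPlay κ K W tie x r c t
    let l := nextStage κ x r p.1 p.2
    (tie.choose p.1 (bestResponses (agentMatrix K r c l + W) (averagePlay x p.1)) :: p.1, l)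

section StagedPlay

variable {m n : ℕ} {κ : ℝ} {K : ℕ} {W : Matrix (Fin m) (Fin n) ℝ} {tie : TieBreaking n}
  {x : List (Fin n) → stdSimplex ℝ (Fin m)} {r : ℕ → Fin m} {c : ℕ → Fin n}

theorem isHistory_stagedPlay : IsHistory fun t => (stagedPlay κ K W tie x r c t).1 :=
  ⟨rfl, fun _ => ⟨_, rfl⟩⟩

theorem stagedPlay_succ_snd (t : ℕ) : (stagedPlay κ K W tie x r c (t + 1)).2 =
    nextStage κ x r (stagedPlay κ K W tie x r c t).1 (stagedPlay κ K W tie x r c t).2 := rfl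

theorem le_nextStage (h : List (Fin n)) (l : ℕ) : l ≤ nextStage κ x r h l := by
  cases l with
  | zero => exact Nat.zero_le _
  | succ l =>
    simp only [nextStage]
    split_ifs <;> omega

theorem stage_mono : Monotone fun t => (stagedPlay κ K W tie x r c t).2 :=
  monotone_nat_of_le_succ fun _ => le_nextStage _ _

theorem nextStage_pos {h : List (Fin n)} (hh : h ≠ []) (l : ℕ) : 0 < nextStage κ x r h l := by
  cases l with
  | zero => simp [nextStage, hh]
  | succ l => exact lt_of_lt_of_le l.succ_pos (le_nextStage h (l + 1))

theorem stagedPlay_one_snd : (stagedPlay κ K W tie x r c 1).2 = 0 := by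
  simp [stagedPlay, nextStage]

/-- All rows below the current stage have been visited. -/
theorem exists_visit_of_lt_stage {t j : ℕ} (h : j + 1 < (stagedPlay κ K W tie x r c t).2) :
    ∃ s < t, κ ≤ averagePlay x (stagedPlay κ K W tie x r c s).1 (r j) := by
  induction t with
  | zero => simp [stagedPlay] at h
  | succ t ih =>
    by_cases h' : j + 1 < (stagedPlay κ K W tie x r c t).2
    · obtain ⟨s, hs, hv⟩ := ih h'
      exact ⟨s, by omega, hv⟩
    · refine ⟨t, by omega, ?_⟩
      rw [stagedPlay_succ_snd] at h
      generalize (stagedPlay κ K W tie x r c t).2 = l at h h'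
      cases l with
      | zero =>
        simp only [nextStage] at h
        split_ifs at h <;> omega
      | succ l =>
        simp only [nextStage] at h
        split_ifs at h with hv
        · rwa [show j = l by omega]
        · omega

/-- Since rows are visited slowly, few levels are revealed in `2 ^ L` rounds. -/
theorem stage_lt (hκ : 1 / 4 ≤ κ) (hr : Set.InjOn r (Set.Iio K)) (hK : 0 < K) {t : ℕ}
    (ht : t ≤ 2 ^ ((K - 1) / 20)) : (stagedPlay κ K W tie x r c t).2 < K := by
  classical
  rcases Nat.eq_zero_or_pos ((K - 1) / 20) with h0 | h0
  · rw [h0, pow_zero] at ht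
    interval_cases t
    · exact hK
    · rw [stagedPlay_one_snd]
      exact hK
  -- with `L = (K - 1) / 20 ≥ 1`, at most `4 + 8 * L < K - 1` rows can be visited
  · by_contra hge
    have hsub : (Finset.range (K - 1)).image r ⊆
        visitedRows x κ (fun t => (stagedPlay κ K W tie x r c t).1) (2 ^ ((K - 1) / 20)) := by
      intro a ha
      obtain ⟨j, hj, rfl⟩ := Finset.mem_image.1 ha
      have hj := Finset.mem_range.1 hj
      obtain ⟨s, hs, hv⟩ := exists_visit_of_lt_stage (κ := κ) (K := K) (W := W) (tie := tie)
        (x := x) (r := r) (c := c) (t := t) (j := j) (by omega)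
      exact Finset.mem_filter.2 ⟨Finset.mem_univ _, s, by omega, hv⟩
    have hcard := (Finset.card_le_card hsub).trans
      (card_visitedRows_le x hκ (q := 4) (by push_cast; linarith) isHistory_stagedPlay _)
    rw [Finset.card_image_of_injOn, Finset.card_range] at hcard
    · omega
    · intro j hj j' hj' e
      have hj := Finset.mem_range.1 hj
      have hj' := Finset.mem_range.1 hj'
      exact hr (Set.mem_Iio.2 (by omega)) (Set.mem_Iio.2 (by omega)) e

theorem agentMatrix_congr {r' : ℕ → Fin m} {c' : ℕ → Fin n} {l : ℕ} (hr : ∀ j < l, r j = r' j)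
    (hc : ∀ j < l, c j = c' j) : agentMatrix K r c l = agentMatrix K r' c' l := by
  ext a b
  refine Finset.sum_congr rfl fun j hj => ?_
  have hj := Finset.mem_range.1 hj
  rw [hc j hj]
  congr 1
  cases j with
  | zero => rfl
  | succ j => simp only [levelUtility, hr j (by omega), hr (j + 1) hj]

/-- The staged play does not depend on levels that are not yet revealed. -/
theorem stagedPlay_congr {r' : ℕ → Fin m} {c' : ℕ → Fin n} {l : ℕ} (hr : ∀ j < l, r j = r' j)
    (hc : ∀ j < l, c j = c' j) {t : ℕ} (ht : (stagedPlay κ K W tie x r c t).2 ≤ l) :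
    stagedPlay κ K W tie x r c t = stagedPlay κ K W tie x r' c' t := by
  induction t with
  | zero => rfl
  | succ t ih =>
    rw [stagedPlay_succ_snd] at ht
    have hle := (le_nextStage (κ := κ) (x := x) (r := r) (stagedPlay κ K W tie x r c t).1
      (stagedPlay κ K W tie x r c t).2).trans ht
    have e := ih hle
    have hstage : nextStage κ x r (stagedPlay κ K W tie x r c t).1
        (stagedPlay κ K W tie x r c t).2 = nextStage κ x r' (stagedPlay κ K W tie x r c t).1
        (stagedPlay κ K W tie x r c t).2 := by
      generalize (stagedPlay κ K W tie x r c t).2 = k at hle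
      cases k with
      | zero => rfl
      | succ k => simp only [nextStage, hr k (by omega)]
    have hmat := agentMatrix_congr (K := K) (l := nextStage κ x r (stagedPlay κ K W tie x r c t).1
      (stagedPlay κ K W tie x r c t).2) (fun j hj => hr j (by omega)) fun j hj => hc j (by omega)
    simp only [stagedPlay]
    rw [hmat, hstage, e]

/-- As long as no row of an unrevealed level is visited, the staged agent plays like the agent who
considers all levels. -/
theorem fictitiousPlay_eq_stagedPlay (hκ : κ < 19 / 50) (hκ' : 1 < K → 3 / 2 * κ < 19 / 50)
    (hc : Set.InjOn c (Set.Iic K)) (hW : ∀ a b, |W a b| ≤ 1 / 100) {T : ℕ}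
    (hstage : ∀ t ≤ T, (stagedPlay κ K W tie x r c t).2 < K)
    (hluck : ∀ t ≤ T, ∀ j < K, (stagedPlay κ K W tie x r c t).2 ≤ j →
      averagePlay x (stagedPlay κ K W tie x r c t).1 (r j) < κ) {t : ℕ} (ht : t ≤ T) :
    fictitiousPlay (agentMatrix K r c (K + 1) + W) tie x t =
      (stagedPlay κ K W tie x r c t).1 := by
  induction t with
  | zero => rfl
  | succ t ih =>
    have hs := hstage (t + 1) ht
    have hl := hluck t (by omega)
    simp only [fictitiousPlay, stagedPlay]
    rw [ih (by omega)]
    rw [stagedPlay_succ_snd] at hs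
    congr 2
    -- in the first round every action is a best response, for both agents
    rcases Nat.eq_zero_or_pos t with rfl | h0
    · simp only [stagedPlay, averagePlay_nil, bestResponses_zero]
    have hne := (isHistory_stagedPlay (κ := κ) (K := K) (W := W) (tie := tie) (x := x) (r := r)
      (c := c)).ne_nil h0
    have hpos := nextStage_pos (κ := κ) (x := x) (r := r) hne (stagedPlay κ K W tie x r c t).2
    have hmono := le_nextStage (κ := κ) (x := x) (r := r) (stagedPlay κ K W tie x r c t).1
      (stagedPlay κ K W tie x r c t).2
    refine (bestResponses_agentMatrix_eq hc (by omega) hpos hW (averagePlay_mem x hne) ?_).symm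
    intro j hj hlj
    obtain ⟨i, rfl⟩ := Nat.exists_eq_succ_of_ne_zero (by omega : j ≠ 0)
    -- row `i` is either unrevealed, or the row that would have triggered the next stage
    have hi : averagePlay x (stagedPlay κ K W tie x r c t).1 (r i) < κ := by
      by_cases hle : (stagedPlay κ K W tie x r c t).2 ≤ i
      · exact hl i (by omega) hle
      · have e : (stagedPlay κ K W tie x r c t).2 = i + 1 := by omega
        rw [e] at hlj
        by_contra hge
        simp only [nextStage, not_lt.1 hge, if_true] at hlj
        omega
    simp only [levelValue]
    split_ifs with hK
    · have := hl (i + 1) hK (by omega)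
      linarith [hκ' (by omega)]
    · linarith

end StagedPlay

/-! ### Hidden paths -/

section Path

variable {m n K N : ℕ} [NeZero m] [NeZero n]

/-- The principal's action for option `q` at level `j`. -/
def optionRow (m N : ℕ) [NeZero m] (j q : ℕ) : Fin m := Fin.ofNat m (j * N + q)

/-- The index of level `j` of the path that takes option `i j` at each level `j < K`; level `K` has
only one option. -/
def pathIndex (i : Fin K → Fin N) (j : ℕ) : ℕ := j * N + if h : j < K then (i ⟨j, h⟩ : ℕ) else 0

/-- The rows of the path `i`, meaningful at levels `j < K`. -/
def pathRow (m : ℕ) [NeZero m] (i : Fin K → Fin N) (j : ℕ) : Fin m := Fin.ofNat m (pathIndex i j)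

/-- The columns of the path `i`, meaningful at levels `j ≤ K`. -/
def pathColumn (n : ℕ) [NeZero n] (i : Fin K → Fin N) (j : ℕ) : Fin n :=
  Fin.ofNat n (pathIndex i j)

theorem optionRow_val (hm : K * N ≤ m) {j q : ℕ} (hj : j < K) (hq : q < N) :
    (optionRow m N j q : ℕ) = j * N + q := by
  refine Nat.mod_eq_of_lt (lt_of_lt_of_le ?_ hm)
  calc j * N + q < j * N + N := by omega
    _ = (j + 1) * N := by ring
    _ ≤ K * N := Nat.mul_le_mul_right N hj

theorem optionRow_inj (hm : K * N ≤ m) {j q j' q' : ℕ} (hj : j < K) (hq : q < N) (hj' : j' < K)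
    (hq' : q' < N) (h : optionRow m N j q = optionRow m N j' q') : j = j' ∧ q = q' := by
  have hN : 0 < N := by omega
  have e := congrArg Fin.val h
  rw [optionRow_val hm hj hq, optionRow_val hm hj' hq'] at e
  have e₁ := congrArg (· / N) e
  have e₂ := congrArg (· % N) e
  simp only [mul_comm _ N, Nat.mul_add_div hN, Nat.div_eq_of_lt hq, Nat.div_eq_of_lt hq',
    Nat.mul_add_mod, Nat.mod_eq_of_lt hq, Nat.mod_eq_of_lt hq', add_zero] at e₁ e₂
  exact ⟨e₁, e₂⟩

theorem pathRow_eq_optionRow (i : Fin K → Fin N) {j : ℕ} (hj : j < K) :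
    pathRow m i j = optionRow m N j (i ⟨j, hj⟩) := by
  simp [pathRow, optionRow, pathIndex, hj]

theorem pathIndex_div (hN : 0 < N) (i : Fin K → Fin N) (j : ℕ) : pathIndex i j / N = j := by
  have h : (if h : j < K then (i ⟨j, h⟩ : ℕ) else 0) < N := by
    split_ifs
    · exact (i _).2
    · exact hN
  rw [pathIndex, mul_comm, Nat.mul_add_div hN, Nat.div_eq_of_lt h, add_zero]

theorem pathIndex_last (i : Fin K → Fin N) : pathIndex i K = K * N := by
  simp [pathIndex]

theorem pathIndex_lt (i : Fin K → Fin N) {j : ℕ} (hj : j < K) : pathIndex i j < K * N := by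
  rw [pathIndex, dif_pos hj]
  calc j * N + i ⟨j, hj⟩ < j * N + N := by have := (i ⟨j, hj⟩).2; omega
    _ = (j + 1) * N := by ring
    _ ≤ K * N := Nat.mul_le_mul_right N hj

theorem pathIndex_le (i : Fin K → Fin N) {j : ℕ} (hj : j ≤ K) : pathIndex i j ≤ K * N := by
  rcases hj.lt_or_eq with hj | rfl
  · exact (pathIndex_lt i hj).le
  · exact (pathIndex_last i).le

theorem pathRow_val (hm : K * N ≤ m) (i : Fin K → Fin N) {j : ℕ} (hj : j < K) :
    (pathRow m i j : ℕ) = pathIndex i j :=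
  Nat.mod_eq_of_lt ((pathIndex_lt i hj).trans_le hm)

theorem pathColumn_val (hn : K * N < n) (i : Fin K → Fin N) {j : ℕ} (hj : j ≤ K) :
    (pathColumn n i j : ℕ) = pathIndex i j :=
  Nat.mod_eq_of_lt ((pathIndex_le i hj).trans_lt hn)

theorem pathRow_injOn (hN : 0 < N) (hm : K * N ≤ m) (i : Fin K → Fin N) :
    Set.InjOn (pathRow m i) (Set.Iio K) := by
  intro j hj j' hj' h
  have e := congrArg Fin.val h
  rw [pathRow_val hm i hj, pathRow_val hm i hj'] at e
  rw [← pathIndex_div hN i j, e, pathIndex_div hN]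

theorem pathColumn_injOn (hN : 0 < N) (hn : K * N < n) (i : Fin K → Fin N) :
    Set.InjOn (pathColumn n i) (Set.Iic K) := by
  intro j hj j' hj' h
  have e := congrArg Fin.val h
  rw [pathColumn_val hn i hj, pathColumn_val hn i hj'] at e
  rw [← pathIndex_div hN i j, e, pathIndex_div hN]

theorem pathIndex_congr {i i' : Fin K → Fin N} {j : ℕ} (h : ∀ k : Fin K, (k : ℕ) = j → i k = i' k) :
    pathIndex i j = pathIndex i' j := by
  by_cases hj : j < K
  · simp [pathIndex, hj, h ⟨j, hj⟩ rfl]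
  · simp [pathIndex, hj]

/-! ### The principal cannot guess the hidden options -/

/-- If a guess at the coordinate `i j` of a uniformly random `i` does not depend on that
coordinate, then it is right with probability proportional to its size. -/
theorem card_mul_card_filter_mem {ι α : Type*} [Fintype ι] [DecidableEq ι] [Fintype α]
    [DecidableEq α] (j : ι) (A : (ι → α) → Finset α)
    (hA : ∀ i v, A (Function.update i j v) = A i) :
    Fintype.card α * (Finset.univ.filter fun i => i j ∈ A i).card = ∑ i, (A i).card := by
  -- exchange the coordinate `i j` with an independent guess `v`
  have hinv : Function.Involutive
      fun p : (ι → α) × α => ((Function.update p.1 j p.2, p.1 j) : (ι → α) × α) := by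
    rintro ⟨i, v⟩
    simp
  have h := Equiv.sum_comp hinv.toPerm fun p : (ι → α) × α => if p.1 j ∈ A p.1 then 1 else 0
  simp only [Function.Involutive.coe_toPerm, Function.update_self, hA,
    Fintype.sum_prod_type] at h
  calc Fintype.card α * (Finset.univ.filter fun i => i j ∈ A i).card
      = ∑ i : ι → α, ∑ _v : α, if i j ∈ A i then 1 else 0 := by
        simp only [Finset.card_filter, Finset.mul_sum, Finset.sum_const, Finset.card_univ,
          smul_eq_mul]
    _ = ∑ i : ι → α, ∑ v : α, if v ∈ A i then 1 else 0 := h.symm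
    _ = ∑ i, (A i).card := by simp

variable (κ : ℝ) (T : ℕ) (W : Matrix (Fin m) (Fin n) ℝ) (tie : TieBreaking n)
  (x : List (Fin n) → stdSimplex ℝ (Fin m)) (hlt : List (Fin n) → Bool)
  (out : List (Fin n) → stdSimplex ℝ (Fin m))

/-- The options of level `j` that are visited, in staged play on the path `i`, before level `j` is
revealed. -/
noncomputable def visitedOptions (i : Fin K → Fin N) (j : Fin K) : Finset (Fin N) :=
  open scoped Classical in
  Finset.univ.filter fun q => ∃ t ≤ T,
    (stagedPlay κ K W tie x (pathRow m i) (pathColumn n i) t).2 ≤ j ∧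
    κ ≤ averagePlay x (stagedPlay κ K W tie x (pathRow m i) (pathColumn n i) t).1
      (optionRow m N j q)

/-- The options of level `j` on which the reported strategy has mass at least `κ`, if a strategy
is reported in the staged play on the path `i` before level `j` is revealed. -/
noncomputable def reportedOptions (i : Fin K → Fin N) (j : Fin K) : Finset (Fin N) :=
  open scoped Classical in
  Finset.univ.filter fun q => ∃ s ≤ T,
    (stagedPlay κ K W tie x (pathRow m i) (pathColumn n i) s).2 ≤ j ∧
    hlt (stagedPlay κ K W tie x (pathRow m i) (pathColumn n i) s).1 = true ∧
    (∀ s' < s, hlt (stagedPlay κ K W tie x (pathRow m i) (pathColumn n i) s').1 = false) ∧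
    κ ≤ out (stagedPlay κ K W tie x (pathRow m i) (pathColumn n i) s).1 (optionRow m N j q)

theorem stagedPlay_path_congr {i i' : Fin K → Fin N} {j : Fin K} (h : ∀ k ≠ j, i k = i' k) {t : ℕ}
    (ht : (stagedPlay κ K W tie x (pathRow m i) (pathColumn n i) t).2 ≤ j) :
    stagedPlay κ K W tie x (pathRow m i) (pathColumn n i) t =
      stagedPlay κ K W tie x (pathRow m i') (pathColumn n i') t := by
  have key : ∀ k < (j : ℕ), pathIndex i k = pathIndex i' k := fun k hk =>
    pathIndex_congr fun k' hk' => h k' fun e => by rw [e] at hk'; omega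
  refine stagedPlay_congr (l := j) (fun k hk => ?_) (fun k hk => ?_) ht
  · simp only [pathRow, key k hk]
  · simp only [pathColumn, key k hk]

theorem visitedOptions_subset {i i' : Fin K → Fin N} {j : Fin K} (h : ∀ k ≠ j, i k = i' k) :
    visitedOptions κ T W tie x i j ⊆ visitedOptions κ T W tie x i' j := by
  intro q hq
  obtain ⟨t, ht, hs, hv⟩ := (Finset.mem_filter.1 hq).2
  have e := stagedPlay_path_congr κ W tie x h hs
  rw [e] at hs hv
  exact Finset.mem_filter.2 ⟨Finset.mem_univ _, t, ht, hs, hv⟩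

theorem reportedOptions_subset {i i' : Fin K → Fin N} {j : Fin K} (h : ∀ k ≠ j, i k = i' k) :
    reportedOptions κ T W tie x hlt out i j ⊆ reportedOptions κ T W tie x hlt out i' j := by
  intro q hq
  obtain ⟨s, hs, hst, hh, hh', hv⟩ := (Finset.mem_filter.1 hq).2
  have e := fun s' (hs' : s' ≤ s) => stagedPlay_path_congr κ W tie x h
    ((stage_mono hs').trans hst)
  have hh'' : ∀ s' < s, hlt (stagedPlay κ K W tie x (pathRow m i') (pathColumn n i') s').1
      = false := fun s' hs' => by rw [← e s' hs'.le]; exact hh' s' hs'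
  rw [e s le_rfl] at hst hh hv
  exact Finset.mem_filter.2 ⟨Finset.mem_univ _, s, hs, hst, hh, hh'', hv⟩

theorem visitedOptions_update (i : Fin K → Fin N) (j : Fin K) (v : Fin N) :
    visitedOptions κ T W tie x (Function.update i j v) j = visitedOptions κ T W tie x i j :=
  (visitedOptions_subset κ T W tie x fun _ hk => Function.update_of_ne hk v i).antisymm
    (visitedOptions_subset κ T W tie x fun _ hk => (Function.update_of_ne hk v i).symm)

theorem reportedOptions_update (i : Fin K → Fin N) (j : Fin K) (v : Fin N) :
    reportedOptions κ T W tie x hlt out (Function.update i j v) j =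
      reportedOptions κ T W tie x hlt out i j :=
  (reportedOptions_subset κ T W tie x hlt out
    fun _ hk => Function.update_of_ne hk v i).antisymm
    (reportedOptions_subset κ T W tie x hlt out
      fun _ hk => (Function.update_of_ne hk v i).symm)

variable {κ}

theorem sum_card_visitedOptions_le (hκ : 1 / 4 ≤ κ) {q : ℕ} (hq : 1 < (q + 1) * κ)
    (hm : K * N ≤ m) (L : ℕ) (i : Fin K → Fin N) :
    ∑ j, (visitedOptions κ (2 ^ L) W tie x i j).card ≤ q + 8 * L := by
  classical
  refine le_trans ?_ (card_visitedRows_le x hκ hq (isHistory_stagedPlay (κ := κ) (K := K) (W := W)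
    (tie := tie) (x := x) (r := pathRow m i) (c := pathColumn n i)) L)
  rw [← Finset.card_sigma]
  refine Finset.card_le_card_of_injOn (fun p => optionRow m N p.1 p.2) ?_ ?_
  · rintro ⟨j, p⟩ hp
    obtain ⟨t, ht, -, hv⟩ := (Finset.mem_filter.1 (Finset.mem_sigma.1 hp).2).2
    exact Finset.mem_coe.2 (Finset.mem_filter.2 ⟨Finset.mem_univ _, t, ht, hv⟩)
  · rintro ⟨j, p⟩ - ⟨j', p'⟩ - h
    obtain ⟨e₁, e₂⟩ := optionRow_inj hm j.2 p.2 j'.2 p'.2 h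
    obtain rfl := Fin.ext e₁
    obtain rfl := Fin.ext e₂
    rfl

theorem card_reportedOptions_le (hκ : 0 < κ) {q : ℕ} (hq : 1 < (q + 1) * κ)
    (hm : K * N ≤ m) (i : Fin K → Fin N) (j : Fin K) :
    (reportedOptions κ T W tie x hlt out i j).card ≤ q := by
  classical
  -- the time `s` of the report is unique
  by_cases hex : ∃ s, hlt (stagedPlay κ K W tie x (pathRow m i) (pathColumn n i) s).1 = true ∧
    (∀ s' < s, hlt (stagedPlay κ K W tie x (pathRow m i) (pathColumn n i) s').1 = false)
  · obtain ⟨s, hs, hs'⟩ := hex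
    set y := out (stagedPlay κ K W tie x (pathRow m i) (pathColumn n i) s).1
    have hinj : Function.Injective fun p : Fin N => optionRow m N j p := fun p p' h =>
      Fin.ext (optionRow_inj hm j.2 p.2 j.2 p'.2 h).2
    refine le_trans (Finset.card_le_card ?_) (card_filter_le_of_sum_le_one
      (y := fun p : Fin N => y (optionRow m N j p)) (fun p => y.2.1 _) ?_ hκ hq)
    · intro p hp
      obtain ⟨u, -, -, hu, hu', hv⟩ := (Finset.mem_filter.1 hp).2
      have e : u = s := by
        rcases lt_trichotomy u s with h | h | h
        · exact absurd hu (by simp [hs' u h])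
        · exact h
        · exact absurd hs (by simp [hu' s h])
      subst e
      exact Finset.mem_filter.2 ⟨Finset.mem_univ _, hv⟩
    · have e : ∑ a, y a = 1 := y.2.2
      rw [← e]
      refine (Finset.sum_map Finset.univ ⟨_, hinj⟩ fun a => y a).symm.trans_le ?_
      exact Finset.sum_le_sum_of_subset_of_nonneg (Finset.subset_univ _) fun a _ _ => y.2.1 a
  · rw [Finset.card_eq_zero.2]
    · exact Nat.zero_le _
    · refine Finset.filter_eq_empty_iff.2 fun p _ => ?_
      rintro ⟨s, -, -, hs, hs', -⟩
      exact hex ⟨s, hs, hs'⟩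

end Path

/-- Within `T` rounds, an average of the principal's play or the strategy that she reports has mass
at least `19 / 50` on row `a`. -/
def HasReached {m n : ℕ} (U : Matrix (Fin m) (Fin n) ℝ) (tie : TieBreaking n)
    (x : List (Fin n) → stdSimplex ℝ (Fin m)) (hlt : List (Fin n) → Bool)
    (out : List (Fin n) → stdSimplex ℝ (Fin m)) (T : ℕ) (a : Fin m) : Prop :=
  (∃ t ≤ T, 19 / 50 ≤ averagePlay x (fictitiousPlay U tie x t) a) ∨
    ∃ s ≤ T, hlt (fictitiousPlay U tie x s) = true ∧
      (∀ s' < s, hlt (fictitiousPlay U tie x s') = false) ∧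
      19 / 50 ≤ out (fictitiousPlay U tie x s) a

section Guess

variable {m n K N : ℕ} [NeZero m] [NeZero n] {κ : ℝ} {W : Matrix (Fin m) (Fin n) ℝ}
  (tie : TieBreaking n) (x : List (Fin n) → stdSimplex ℝ (Fin m)) (hlt : List (Fin n) → Bool)
  (out : List (Fin n) → stdSimplex ℝ (Fin m))

/-- The last row of a path is reached early only by a lucky guess: of a hidden option of some
level, or of the last option in the report. -/
theorem exists_guess_of_hasReached (hκ : 1 / 4 ≤ κ) (hκ₁ : κ < 19 / 50)
    (hκ' : 1 < K → 3 / 2 * κ < 19 / 50) (hK : 0 < K) (hN : 0 < N) (hm : K * N ≤ m)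
    (hn : K * N < n) (hW : ∀ a b, |W a b| ≤ 1 / 100) (i : Fin K → Fin N)
    (h : HasReached (agentMatrix K (pathRow m i) (pathColumn n i) (K + 1) + W) tie x hlt out
      (2 ^ ((K - 1) / 20)) (pathRow m i (K - 1))) :
    (∃ j, i j ∈ visitedOptions κ (2 ^ ((K - 1) / 20)) W tie x i j) ∨
      i ⟨K - 1, by omega⟩ ∈
        reportedOptions κ (2 ^ ((K - 1) / 20)) W tie x hlt out i ⟨K - 1, by omega⟩ := by
  classical
  by_contra hcon
  push Not at hcon
  obtain ⟨hvis, hrep⟩ := hcon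
  have hstage : ∀ t ≤ 2 ^ ((K - 1) / 20),
      (stagedPlay κ K W tie x (pathRow m i) (pathColumn n i) t).2 < K := fun t ht =>
    stage_lt hκ (pathRow_injOn hN hm i) hK ht
  have hluck : ∀ t ≤ 2 ^ ((K - 1) / 20), ∀ j < K,
      (stagedPlay κ K W tie x (pathRow m i) (pathColumn n i) t).2 ≤ j →
      averagePlay x (stagedPlay κ K W tie x (pathRow m i) (pathColumn n i) t).1
        (pathRow m i j) < κ := by
    intro t ht j hj hs
    by_contra hge
    rw [pathRow_eq_optionRow i hj, not_lt] at hge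
    exact hvis ⟨j, hj⟩ (Finset.mem_filter.2 ⟨Finset.mem_univ _, t, ht, hs, hge⟩)
  have heq := fun t ht => fictitiousPlay_eq_stagedPlay (t := t) hκ₁ hκ'
    (pathColumn_injOn hN hn i) hW hstage hluck ht
  rcases h with ⟨t, ht, hv⟩ | ⟨s, hs, hh, hh', hv⟩
  · rw [heq t ht] at hv
    have := hluck t ht (K - 1) (by omega) (by have := hstage t ht; omega)
    linarith
  · refine hrep (Finset.mem_filter.2 ⟨Finset.mem_univ _, s, hs, ?_, ?_, ?_, ?_⟩)
    · have := hstage s hs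
      simp only
      omega
    · rwa [← heq s hs]
    · intro s' hs'
      rw [← heq s' (by omega)]
      exact hh' s' hs'
    · rw [heq s hs, pathRow_eq_optionRow i (by omega)] at hv
      exact hκ₁.le.trans hv

/-- On at most a fraction `(2 * q + 8 * L) / N` of the paths, where `L = (K - 1) / 20`, the last row
is reached within `2 ^ L` rounds. -/
theorem mul_card_hasReached_le (hκ : 1 / 4 ≤ κ) (hκ₁ : κ < 19 / 50)
    (hκ' : 1 < K → 3 / 2 * κ < 19 / 50) {q : ℕ} (hq : 1 < (q + 1) * κ) (hK : 0 < K) (hN : 0 < N)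
    (hm : K * N ≤ m) (hn : K * N < n) (hW : ∀ a b, |W a b| ≤ 1 / 100) {B : Finset (Fin K → Fin N)}
    (hB : ∀ i ∈ B, HasReached (agentMatrix K (pathRow m i) (pathColumn n i) (K + 1) + W) tie x hlt
      out (2 ^ ((K - 1) / 20)) (pathRow m i (K - 1))) :
    N * B.card ≤ (2 * q + 8 * ((K - 1) / 20)) * N ^ K := by
  classical
  set T := 2 ^ ((K - 1) / 20) with hT
  set last : Fin K := ⟨K - 1, by omega⟩ with hlast
  have hsub : B ⊆ (Finset.univ.biUnion fun j =>
      Finset.univ.filter fun i : Fin K → Fin N => i j ∈ visitedOptions κ T W tie x i j) ∪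
      Finset.univ.filter fun i => i last ∈ reportedOptions κ T W tie x hlt out i last := by
    intro i hi
    rcases exists_guess_of_hasReached tie x hlt out hκ hκ₁ hκ' hK hN hm hn hW i (hB i hi)
      with ⟨j, hj⟩ | h
    · exact Finset.mem_union_left _ (Finset.mem_biUnion.2
        ⟨j, Finset.mem_univ _, Finset.mem_filter.2 ⟨Finset.mem_univ _, hj⟩⟩)
    · exact Finset.mem_union_right _ (Finset.mem_filter.2 ⟨Finset.mem_univ _, h⟩)
  have hvis := fun j => card_mul_card_filter_mem j
    (fun i : Fin K → Fin N => visitedOptions κ T W tie x i j)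
    fun i v => visitedOptions_update κ T W tie x i j v
  have hrep := card_mul_card_filter_mem last
    (fun i : Fin K → Fin N => reportedOptions κ T W tie x hlt out i last)
    fun i v => reportedOptions_update κ T W tie x hlt out i last v
  simp only [Fintype.card_fin] at hvis hrep
  calc N * B.card
      ≤ N * ((∑ j, (Finset.univ.filter fun i : Fin K → Fin N =>
          i j ∈ visitedOptions κ T W tie x i j).card) +
          (Finset.univ.filter fun i =>
            i last ∈ reportedOptions κ T W tie x hlt out i last).card) := by
        refine Nat.mul_le_mul_left _ ((Finset.card_le_card hsub).trans
          ((Finset.card_union_le _ _).trans (Nat.add_le_add_right Finset.card_biUnion_le _)))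
    _ = ∑ i : Fin K → Fin N, (∑ j, (visitedOptions κ T W tie x i j).card +
          (reportedOptions κ T W tie x hlt out i last).card) := by
        rw [mul_add, Finset.mul_sum, hrep, Finset.sum_add_distrib, Finset.sum_comm]
        simp only [hvis]
    _ ≤ ∑ _i : Fin K → Fin N, (q + 8 * ((K - 1) / 20) + q) :=
        Finset.sum_le_sum fun i _ => Nat.add_le_add
          (sum_card_visitedOptions_le W tie x hκ hq hm _ i)
          (card_reportedOptions_le T W tie x hlt out (by linarith) hq hm i last)
    _ = (2 * q + 8 * ((K - 1) / 20)) * N ^ K := by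
        simp
        ring

/-- With `9 * K` options per level, most paths stay hidden. For `K = 1` the count needs the larger
threshold `κ = 3 / 8`, which only two rows can pass at a time. -/
theorem nine_mul_card_hasReached_le (hK : 0 < K) (hm : K * (9 * K) ≤ m) (hn : K * (9 * K) < n)
    (hW : ∀ a b, |W a b| ≤ 1 / 100) {B : Finset (Fin K → Fin (9 * K))}
    (hB : ∀ i ∈ B, HasReached (agentMatrix K (pathRow m i) (pathColumn n i) (K + 1) + W) tie x hlt
      out (2 ^ ((K - 1) / 20)) (pathRow m i (K - 1))) :
    9 * B.card ≤ 4 * (9 * K) ^ K := by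
  have key : ∀ q : ℕ, 2 * q + 8 * ((K - 1) / 20) ≤ 4 * K →
      9 * K * B.card ≤ (2 * q + 8 * ((K - 1) / 20)) * (9 * K) ^ K →
      9 * B.card ≤ 4 * (9 * K) ^ K := by
    intro q hq h
    have h' := h.trans (Nat.mul_le_mul_right ((9 * K) ^ K) hq)
    refine Nat.le_of_mul_le_mul_left ?_ hK
    calc K * (9 * B.card) = 9 * K * B.card := by ring
      _ ≤ _ := h'
      _ = K * (4 * (9 * K) ^ K) := by ring
  rcases Nat.lt_or_ge 1 K with h1 | h1
  · exact key 4 (by omega) (mul_card_hasReached_le (κ := 1 / 4) tie x hlt out le_rfl (by norm_num)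
      (fun _ => by norm_num) (by norm_num) hK (by omega) hm hn hW hB)
  · exact key 2 (by omega) (mul_card_hasReached_le (κ := 3 / 8) tie x hlt out (by norm_num)
      (by norm_num) (fun h => absurd h (by omega)) (by norm_num) hK (by omega) hm hn hW hB)

end Guess

/-! ### The random game -/

/-- The principal's utilities, which do not depend on the hidden path: column `j * N + q`, with
`j < K` and `q < N`, belongs to option `q` of level `j` and rewards the row of the same index;
column `K * N` belongs to level `K`. -/
noncomputable def principalMatrix (m n : ℕ) (ε : ℝ) (K N : ℕ) : Matrix (Fin m) (Fin n) ℝ :=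
  fun a b =>
    if (b : ℕ) < K * N then
      baseUtility ε (b / N) + if (a : ℕ) = b then 11 / 5 * ε else 0
    else if (b : ℕ) = K * N then baseUtility ε K else 0

theorem baseUtility_nonneg {ε : ℝ} (hε : 0 ≤ ε) (j : ℕ) : 0 ≤ baseUtility ε j := by
  unfold baseUtility
  positivity

theorem baseUtility_add_le {ε : ℝ} (hε : 0 ≤ ε) {j K : ℕ} (hj : j < K) :
    baseUtility ε j + 11 / 5 * ε ≤ baseUtility ε K := by
  have h : (((2 * j - 1 : ℕ) : ℝ) + 1) ≤ ((2 * K - 1 : ℕ) : ℝ) := by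
    exact_mod_cast (by omega : 2 * j - 1 + 1 ≤ 2 * K - 1)
  unfold baseUtility
  nlinarith

theorem principalMatrix_mem_Icc {m n : ℕ} {ε : ℝ} (hε : 0 ≤ ε) {K N : ℕ}
    (hK : baseUtility ε K ≤ 1) (a : Fin m) (b : Fin n) :
    principalMatrix m n ε K N a b ∈ Set.Icc (0 : ℝ) 1 := by
  unfold principalMatrix
  split_ifs with h₁ h₂ h₃
  · have h := baseUtility_add_le hε ((Nat.div_lt_iff_lt_mul (by
      rcases Nat.eq_zero_or_pos N with rfl | h
      · simp at h₁
      · exact h)).2 h₁)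
    have := baseUtility_nonneg hε ((b : ℕ) / N)
    exact ⟨by positivity, h.trans hK⟩
  · have h := baseUtility_add_le hε ((Nat.div_lt_iff_lt_mul (by
      rcases Nat.eq_zero_or_pos N with rfl | h
      · simp at h₁
      · exact h)).2 h₁)
    exact ⟨by linarith [baseUtility_nonneg hε ((b : ℕ) / N)], by linarith⟩
  · exact ⟨baseUtility_nonneg hε K, hK⟩
  · simp

theorem fitsPath_principalMatrix {m n : ℕ} [NeZero m] [NeZero n] (ε : ℝ) {K N : ℕ} (hN : 0 < N)
    (hm : K * N ≤ m) (hn : K * N < n) (i : Fin K → Fin N) :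
    FitsPath ε K (pathRow m i) (pathColumn n i) (principalMatrix m n ε K N) where
  inner j hj a := by
    have e : (a : ℕ) = pathIndex i j ↔ a = pathRow m i j := by
      rw [Fin.ext_iff, pathRow_val hm i hj]
    simp only [principalMatrix, pathColumn_val hn i hj.le, pathIndex_lt i hj, if_true,
      pathIndex_div hN, e]
  last a := by
    simp only [principalMatrix, pathColumn_val hn i le_rfl, pathIndex_last, lt_irrefl, if_false,
      if_true]

/-- The game with hidden path `i`. -/
noncomputable def pathGame {m n : ℕ} [NeZero m] [NeZero n] {ε : ℝ} (hε : 0 ≤ ε) {K N : ℕ}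
    (hN : 0 < N) (hm : K * N ≤ m) (hn : K * N < n) (hK : baseUtility ε K ≤ 1)
    (i : Fin K → Fin N) : StageGame m n where
  U₁ := principalMatrix m n ε K N
  U₂ := agentMatrix K (pathRow m i) (pathColumn n i) (K + 1)
  U₁_mem := principalMatrix_mem_Icc hε hK
  U₂_mem := agentMatrix_mem_Icc (pathRow_injOn hN hm i) (pathColumn_injOn hN hn i)

/-! ### Measurability in the seed -/

section Measurability

variable {m n : ℕ} {Ω : Type*} [MeasurableSpace Ω] {play : Ω → List (Fin n) → stdSimplex ℝ (Fin m)}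
  (U : Matrix (Fin m) (Fin n) ℝ) (tie : TieBreaking n)

theorem measurable_simplex_apply {f : Ω → stdSimplex ℝ (Fin m)} (hf : Measurable f) (a : Fin m) :
    Measurable fun ω => (f ω : Fin m → ℝ) a :=
  (measurable_pi_apply a).comp (measurable_subtype_coe.comp hf)

theorem measurable_averagePlay (hplay : ∀ h, Measurable fun ω => play ω h) (h : List (Fin n))
    (a : Fin m) : Measurable fun ω => averagePlay (play ω) h a := by
  refine Measurable.const_mul (f := fun ω => cumulativePlay (play ω) h a) ?_ _
  induction h with
  | nil => exact measurable_const
  | cons y h ih => exact ih.add (measurable_simplex_apply (hplay h) a)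

theorem measurableSet_bestResponses_eq (hplay : ∀ h, Measurable fun ω => play ω h)
    (h : List (Fin n)) (S : Finset (Fin n)) :
    MeasurableSet {ω | bestResponses U (averagePlay (play ω) h) = S} := by
  have hval : ∀ b, Measurable fun ω => (averagePlay (play ω) h ᵥ* U) b := fun b =>
    Finset.measurable_sum (f := fun a ω => averagePlay (play ω) h a * U a b) Finset.univ
      fun a _ => (measurable_averagePlay hplay h a).mul_const _
  have hmem : ∀ b, MeasurableSet {ω | b ∈ bestResponses U (averagePlay (play ω) h)} := by
    intro b
    simp only [mem_bestResponses, Set.ofPred_forall]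
    exact MeasurableSet.iInter fun b' => measurableSet_le (hval b') (hval b)
  simp only [Finset.ext_iff, Set.ofPred_forall]
  refine MeasurableSet.iInter fun b => ?_
  by_cases hb : b ∈ S
  · simpa [hb] using hmem b
  · simp only [hb, iff_false]
    exact (hmem b).compl

theorem measurableSet_fictitiousPlay_eq (hplay : ∀ h, Measurable fun ω => play ω h) (t : ℕ)
    (h : List (Fin n)) : MeasurableSet {ω | fictitiousPlay U tie (play ω) t = h} := by
  induction t generalizing h with
  | zero => exact MeasurableSet.const ([] = h)
  | succ t ih =>
    cases h with
    | nil => simp [fictitiousPlay]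
    | cons y h =>
      have e : {ω | fictitiousPlay U tie (play ω) (t + 1) = y :: h} =
          {ω | fictitiousPlay U tie (play ω) t = h} ∩
            ⋃ S ∈ {S | tie.choose h S = y},
              {ω | bestResponses U (averagePlay (play ω) h) = S} := by
        ext ω
        simp only [fictitiousPlay, List.cons.injEq, Set.mem_ofPred_eq, Set.mem_inter_iff,
          Set.mem_iUnion, exists_prop, exists_eq_right']
        constructor
        · rintro ⟨h₁, rfl⟩
          exact ⟨rfl, h₁⟩
        · rintro ⟨rfl, h₁⟩
          exact ⟨h₁, rfl⟩
      rw [e]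
      exact (ih h).inter (MeasurableSet.biUnion (Set.to_countable _) fun S _ =>
        measurableSet_bestResponses_eq U hplay h S)

theorem measurableSet_fictitiousPlay (hplay : ∀ h, Measurable fun ω => play ω h) (t : ℕ)
    {P : Ω → List (Fin n) → Prop} (hP : ∀ h, MeasurableSet {ω | P ω h}) :
    MeasurableSet {ω | P ω (fictitiousPlay U tie (play ω) t)} := by
  have e : {ω | P ω (fictitiousPlay U tie (play ω) t)} =
      ⋃ h, {ω | fictitiousPlay U tie (play ω) t = h} ∩ {ω | P ω h} := by
    ext ω
    simp
  rw [e]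
  exact MeasurableSet.iUnion fun h =>
    (measurableSet_fictitiousPlay_eq U tie hplay t h).inter (hP h)

theorem measurableSet_hasReached {hlt : Ω → List (Fin n) → Bool}
    {out : Ω → List (Fin n) → stdSimplex ℝ (Fin m)} (hplay : ∀ h, Measurable fun ω => play ω h)
    (hhlt : ∀ h, Measurable fun ω => hlt ω h) (hout : ∀ h, Measurable fun ω => out ω h) (T : ℕ)
    (a : Fin m) : MeasurableSet {ω | HasReached U tie (play ω) (hlt ω) (out ω) T a} := by
  have hbool : ∀ (v : Bool) h, MeasurableSet {ω | hlt ω h = v} := fun v h =>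
    hhlt h (measurableSet_singleton v)
  simp only [HasReached, Set.ofPred_or, Set.ofPred_exists, Set.ofPred_and, Set.ofPred_forall]
  refine MeasurableSet.union ?_ ?_
  · refine MeasurableSet.iUnion fun t => (MeasurableSet.const _).inter ?_
    exact measurableSet_fictitiousPlay U tie hplay t
      (P := fun ω h => 19 / 50 ≤ averagePlay (play ω) h a)
      fun h => measurableSet_le measurable_const (measurable_averagePlay hplay h a)
  · refine MeasurableSet.iUnion fun s => (MeasurableSet.const _).inter
      (MeasurableSet.inter ?_ (MeasurableSet.inter ?_ ?_))
    · exact measurableSet_fictitiousPlay U tie hplay s (P := fun ω h => hlt ω h = true)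
        fun h => hbool true h
    · exact MeasurableSet.iInter fun s' => MeasurableSet.iInter fun _ =>
        measurableSet_fictitiousPlay U tie hplay s' (P := fun ω h => hlt ω h = false)
          fun h => hbool false h
    · exact measurableSet_fictitiousPlay U tie hplay s
        (P := fun ω h => 19 / 50 ≤ (out ω h : Fin m → ℝ) a)
        fun h => measurableSet_le measurable_const (measurable_simplex_apply (hout h) a)

end Measurability

/-! ### The expected number of rounds -/

theorem le_iterationsToFind {m n : ℕ} {Ω : Type*} [MeasurableSpace Ω] [NeZero n] {ε δ : ℝ} {K : ℕ}
    {r : ℕ → Fin m} {c : ℕ → Fin n} {U₁ W : Matrix (Fin m) (Fin n) ℝ} {tie : TieBreaking n}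
    {alg : PrincipalAlgorithm m n Ω} {ω : Ω} {T : ℕ}
    (hε : 0 < ε) (hδ : δ ∈ Set.Ioc (0 : ℝ) 2) (hK : 0 < K) (hr : Set.InjOn r (Set.Iio K))
    (hc : Set.InjOn c (Set.Iic K)) (hU : FitsPath ε K r c U₁) (hW : ∀ a b, |W a b| ≤ 1 / 100)
    (h : ¬ HasReached (agentMatrix K r c (K + 1) + W) tie (alg.play ω U₁) (alg.halts ω U₁)
      (alg.output ω U₁) T (r (K - 1))) :
    ((T + 1 : ℕ) : ℝ≥0∞) ≤
      iterationsToFind U₁ (agentMatrix K r c (K + 1) + W) ε δ tie alg ω := by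
  refine le_iInf₂ fun t ht => ?_
  by_contra hlt
  have hle : t ≤ T := by
    have : t < T + 1 := by exact_mod_cast not_le.1 hlt
    omega
  refine h ?_
  rcases ht with ht | ⟨s, hs, h₁, h₂, h₃⟩
  · exact Or.inl ⟨t, hle, le_of_isApproxLocalStackelberg hε hδ hK hr hc hU hW ht⟩
  · exact Or.inr ⟨s, hs.trans hle, h₁, h₂,
      le_of_isApproxLocalStackelberg hε hδ hK hr hc hU hW h₃⟩

theorem tsum_map_uniformOfFintype_mul {ι α : Type*} [Fintype ι] [Nonempty ι] (f : ι → α)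
    (F : α → ℝ≥0∞) : ∑' a, (PMF.uniformOfFintype ι).map f a * F a =
      (Fintype.card ι : ℝ≥0∞)⁻¹ * ∑ i, F (f i) := by
  classical
  simp only [PMF.map_apply, PMF.uniformOfFintype_apply, tsum_fintype, Finset.sum_mul]
  rw [Summable.tsum_finsetSum fun i _ => ENNReal.summable, Finset.mul_sum]
  refine Finset.sum_congr rfl fun i _ => ?_
  rw [tsum_eq_single (f i) fun a ha => by simp [ha]]
  simp

/-- If every seed lies in at least `k` of the events, then the probabilities of the events add up to
at least `k`. -/
theorem le_sum_measure_of_le_sum_indicator {ι Ω : Type*} [Fintype ι] [MeasurableSpace Ω]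
    (μ : MeasureTheory.Measure Ω) [MeasureTheory.IsProbabilityMeasure μ] {B : ι → Set Ω}
    (hB : ∀ i, MeasurableSet (B i)) {k : ℝ≥0∞}
    (h : ∀ ω, k ≤ ∑ i, (B i).indicator 1 ω) : k ≤ ∑ i, μ (B i) := by
  calc k = ∫⁻ _, k ∂μ := by simp
    _ ≤ ∫⁻ ω, ∑ i, (B i).indicator 1 ω ∂μ := MeasureTheory.lintegral_mono h
    _ = ∑ i, ∫⁻ ω, (B i).indicator 1 ω ∂μ :=
        MeasureTheory.lintegral_finsetSum _ fun i _ => measurable_one.indicator (hB i)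
    _ = ∑ i, μ (B i) := by simp only [MeasureTheory.lintegral_indicator_one (hB _)]

/-- With `L = (K - 1) / 20`, at least `5 / 9` of the paths survive `2 ^ L` rounds, whatever the seed;
on these, at least `2 ^ L + 1` rounds are needed. -/
theorem le_expected_iterations {m n : ℕ} [NeZero m] [NeZero n] {ε δ : ℝ} (hε : 0 < ε)
    (hδ : δ ∈ Set.Ioc (0 : ℝ) 2) {K : ℕ} (hK : 0 < K) (hm : K * (9 * K) ≤ m)
    (hn : K * (9 * K) < n) (hbase : baseUtility ε K ≤ 1) {W : Matrix (Fin m) (Fin n) ℝ}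
    (hW : ∀ a b, |W a b| ≤ 1 / 100) (tie : TieBreaking n) {Ω : Type*} [MeasurableSpace Ω]
    (μ : MeasureTheory.Measure Ω) [MeasureTheory.IsProbabilityMeasure μ]
    (alg : PrincipalAlgorithm m n Ω) [Nonempty (Fin K → Fin (9 * K))] :
    ENNReal.ofReal ((2 ^ ((K - 1) / 20) + 1) * (5 / 9)) ≤
      ∑' G, (PMF.uniformOfFintype (Fin K → Fin (9 * K))).map
        (pathGame hε.le (by omega : 0 < 9 * K) hm hn hbase) G *
          ∫⁻ ω, iterationsToFind G.U₁ (G.U₂ + W) ε δ tie alg ω ∂μ := by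
  classical
  rw [tsum_map_uniformOfFintype_mul]
  set T := 2 ^ ((K - 1) / 20) with hT
  have hN : 0 < 9 * K := by omega
  set U₁ := principalMatrix m n ε K (9 * K) with hU₁
  set B : (Fin K → Fin (9 * K)) → Set Ω := fun i => {ω | HasReached
    (agentMatrix K (pathRow m i) (pathColumn n i) (K + 1) + W) tie (alg.play ω U₁)
    (alg.halts ω U₁) (alg.output ω U₁) T (pathRow m i (K - 1))} with hBdef
  have hBmeas : ∀ i, MeasurableSet (B i) := fun i =>
    measurableSet_hasReached _ tie (alg.measurable_play U₁) (alg.measurable_halts U₁)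
      (alg.measurable_output U₁) T _
  have hint : ∀ i, ((T + 1 : ℕ) : ℝ≥0∞) * μ (B i)ᶜ ≤
      ∫⁻ ω, iterationsToFind U₁ (agentMatrix K (pathRow m i) (pathColumn n i) (K + 1) + W) ε δ tie
        alg ω ∂μ := by
    intro i
    rw [← MeasureTheory.lintegral_indicator_const (hBmeas i).compl]
    refine MeasureTheory.lintegral_mono fun ω => ?_
    by_cases hω : ω ∈ (B i)ᶜ
    · rw [Set.indicator_of_mem hω]
      exact le_iterationsToFind hε hδ hK (pathRow_injOn hN hm i) (pathColumn_injOn hN hn i)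
        (fitsPath_principalMatrix ε hN hm hn i) hW hω
    · rw [Set.indicator_of_notMem hω]
      exact bot_le
  have hcard : (Fintype.card (Fin K → Fin (9 * K)) : ℝ≥0∞) * ENNReal.ofReal (5 / 9) ≤
      ∑ i, μ (B i)ᶜ := by
    refine le_sum_measure_of_le_sum_indicator μ (fun i => (hBmeas i).compl) fun ω => ?_
    have h := nine_mul_card_hasReached_le (B := Finset.univ.filter fun i => ω ∈ B i) tie
      (alg.play ω U₁) (alg.halts ω U₁) (alg.output ω U₁) hK hm hn hW
      fun i hi => (Finset.mem_filter.1 hi).2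
    have hsum : ∑ i, (B i)ᶜ.indicator (1 : Ω → ℝ≥0∞) ω =
        ((Finset.univ.filter fun i => ω ∉ B i).card : ℝ≥0∞) := by
      rw [Finset.card_filter]
      push_cast
      exact Finset.sum_congr rfl fun i _ => by simp [Set.indicator_apply]
    have htot := Finset.card_filter_add_card_filter_not
      (s := (Finset.univ : Finset (Fin K → Fin (9 * K)))) (fun i => ω ∈ B i)
    have hpow : Fintype.card (Fin K → Fin (9 * K)) = (9 * K) ^ K := by simp
    rw [Finset.card_univ, hpow] at htot
    rw [hsum, hpow, ← ENNReal.ofReal_natCast, ← ENNReal.ofReal_natCast,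
      ← ENNReal.ofReal_mul (Nat.cast_nonneg _)]
    refine ENNReal.ofReal_le_ofReal ?_
    have h' : (5 * (9 * K) ^ K : ℕ) ≤ 9 * (Finset.univ.filter fun i => ω ∉ B i).card := by omega
    have h'' : ((5 * (9 * K) ^ K : ℕ) : ℝ) ≤
        ((9 * (Finset.univ.filter fun i => ω ∉ B i).card : ℕ) : ℝ) := Nat.cast_le.2 h'
    rw [Nat.cast_mul, Nat.cast_mul] at h''
    push_cast at h'' ⊢
    linarith
  have hcard₀ : (Fintype.card (Fin K → Fin (9 * K)) : ℝ≥0∞) ≠ 0 := by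
    exact_mod_cast Fintype.card_ne_zero
  have hT' : ENNReal.ofReal ((2 ^ ((K - 1) / 20) + 1) * (5 / 9)) =
      ((T + 1 : ℕ) : ℝ≥0∞) * ENNReal.ofReal (5 / 9) := by
    rw [← ENNReal.ofReal_natCast, ← ENNReal.ofReal_mul (Nat.cast_nonneg _), hT]
    push_cast
    rfl
  rw [hT', mul_comm (_ : ℝ≥0∞)⁻¹, ← div_eq_mul_inv,
    ENNReal.le_div_iff_mul_le (Or.inl hcard₀) (Or.inl (ENNReal.natCast_ne_top _))]
  calc ((T + 1 : ℕ) : ℝ≥0∞) * ENNReal.ofReal (5 / 9) * (Fintype.card (Fin K → Fin (9 * K)) : ℝ≥0∞)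
      = ((T + 1 : ℕ) : ℝ≥0∞) *
          ((Fintype.card (Fin K → Fin (9 * K)) : ℝ≥0∞) * ENNReal.ofReal (5 / 9)) := by ring
    _ ≤ ((T + 1 : ℕ) : ℝ≥0∞) * ∑ i, μ (B i)ᶜ := mul_le_mul_right hcard _
    _ = ∑ i, ((T + 1 : ℕ) : ℝ≥0∞) * μ (B i)ᶜ := Finset.mul_sum _ _ _
    _ ≤ _ := Finset.sum_le_sum fun i _ => hint i

/-! ### Choice of parameters -/

theorem exp_le_two_pow {ε : ℝ} {K : ℕ} (hK : 1 / ε ≤ 9 * K) :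
    Real.exp (1 / 2000 / ε) ≤ (2 ^ ((K - 1) / 20) + 1) * (5 / 9) := by
  set L := (K - 1) / 20 with hL
  have hKL : (K : ℝ) ≤ 20 * (L + 1) := by exact_mod_cast (by omega : K ≤ 20 * (L + 1))
  have h₁ : 1 / 2000 / ε ≤ ((L + 1 : ℕ) : ℝ) * (9 / 100) := by
    have e : 1 / 2000 / ε = 1 / 2000 * (1 / ε) := by ring
    rw [e]
    push_cast
    linarith
  have h₂ : Real.exp (9 / 100) ≤ 10 / 9 := by
    have h := Real.one_sub_le_exp_neg (9 / 100)
    rw [Real.exp_neg] at h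
    have h' := inv_anti₀ (by norm_num) h
    rw [inv_inv] at h'
    exact h'.trans (by norm_num)
  have h₃ : ∀ L : ℕ, (10 / 9 : ℝ) ^ (L + 1) ≤ (2 ^ L + 1) * (5 / 9) := by
    intro L
    induction L with
    | zero => norm_num
    | succ L ih =>
      have : (1 : ℝ) ≤ 2 ^ L := one_le_pow₀ (by norm_num)
      rw [pow_succ, pow_succ 2 L]
      linarith
  calc Real.exp (1 / 2000 / ε) ≤ Real.exp (((L + 1 : ℕ) : ℝ) * (9 / 100)) := Real.exp_le_exp.2 h₁
    _ = Real.exp (9 / 100) ^ (L + 1) := Real.exp_nat_mul _ _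
    _ ≤ (10 / 9) ^ (L + 1) := pow_le_pow_left₀ (Real.exp_pos _).le h₂ _
    _ ≤ _ := h₃ L

/-- There is room for about `1 / (6 * ε)` levels: the utilities of the principal fit into the unit
interval, and the rows and columns suffice for `9 * K` options per level. -/
theorem exists_levels {ε : ℝ} (hε : ε ∈ Set.Ioo (0 : ℝ) (1 / 3)) {n m : ℕ}
    (hn : 1 / ε ^ 2 ≤ (n : ℝ)) (hm : 1 / ε ^ 5 ≤ (m : ℝ)) :
    ∃ K : ℕ, 0 < K ∧ baseUtility ε K ≤ 1 ∧ 1 / ε ≤ 9 * K ∧ K * (9 * K) < n ∧ K * (9 * K) < m := by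
  obtain ⟨h0, h1⟩ := hε
  have h6 : 0 < 6 * ε := by linarith
  set K := ⌊(1 + 3 * ε) / (6 * ε)⌋₊ with hKdef
  have hle : (K : ℝ) * (6 * ε) ≤ 1 + 3 * ε :=
    (le_div_iff₀ h6).1 (Nat.floor_le (by positivity))
  have hlt : 1 + 3 * ε < (K + 1) * (6 * ε) := (div_lt_iff₀ h6).1 (Nat.lt_floor_add_one _)
  have hK : 0 < K := Nat.floor_pos.2 ((le_div_iff₀ h6).2 (by linarith))
  have hK' : (1 : ℝ) ≤ K := by exact_mod_cast hK
  have hsq : ((K * (9 * K) : ℕ) : ℝ) < 1 / ε ^ 2 := by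
    rw [lt_div_iff₀ (by positivity)]
    push_cast
    have h : 0 ≤ 3 * K * ε := by positivity
    have h' : 3 * K * ε < 1 := by linarith
    nlinarith
  have hpow : 1 / ε ^ 2 ≤ 1 / ε ^ 5 :=
    one_div_le_one_div_of_le (by positivity)
      (pow_le_pow_of_le_one h0.le (by linarith) (by norm_num))
  refine ⟨K, hK, ?_, ?_, ?_, ?_⟩
  · obtain ⟨k, hk⟩ := Nat.exists_eq_succ_of_ne_zero hK.ne'
    rw [hk, Nat.succ_eq_add_one, baseUtility_succ]
    rw [hk] at hle
    push_cast at hle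
    linarith
  · rw [div_le_iff₀ h0]
    nlinarith
  · exact_mod_cast hsq.trans_le hn
  · exact_mod_cast hsq.trans_le (hpow.trans hm)

theorem mainTheorem2 :
    ∃ C > (0 : ℝ), ∃ η > (0 : ℝ), ∃ c > (0 : ℝ),
      ∀ ε ∈ Set.Ioo (0 : ℝ) (1 / 3), ∀ n m : ℕ, 1 / ε ^ 2 ≤ (n : ℝ) → 1 / ε ^ 5 ≤ (m : ℝ) →
        ∃ D : PMF (StageGame m n),
          ∀ W : Matrix (Fin m) (Fin n) ℝ, (∀ a b, |W a b| ≤ η) →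
            (∀ G ∈ D.support, FarFromBoundary (G.U₂ + W) (c / m)) ∧
            ∀ δ ∈ Set.Ioc (0 : ℝ) 2, ∀ tie : TieBreaking n,
              ∀ {Ω : Type*} [MeasurableSpace Ω] (μ : MeasureTheory.Measure Ω)
                [MeasureTheory.IsProbabilityMeasure μ] (alg : PrincipalAlgorithm m n Ω),
                ENNReal.ofReal (Real.exp (C / ε)) ≤
                  ∑' G, D G * ∫⁻ ω, iterationsToFind G.U₁ (G.U₂ + W) ε δ tie alg ω ∂μ := by
  refine ⟨1 / 2000, by norm_num, 1 / 100, by norm_num, 1 / 10, by norm_num, ?_⟩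
  intro ε hε n m hn hm
  obtain ⟨K, hK, hbase, hKε, hKn, hKm⟩ := exists_levels hε hn hm
  have hm9 : 9 ≤ m := by nlinarith
  have : NeZero m := NeZero.of_pos (by omega)
  have : NeZero n := NeZero.of_pos (by omega)
  have hN : 0 < 9 * K := by omega
  have : Nonempty (Fin K → Fin (9 * K)) := ⟨fun _ => ⟨0, hN⟩⟩
  refine ⟨(PMF.uniformOfFintype (Fin K → Fin (9 * K))).map
    (pathGame hε.1.le hN hKm.le hKn hbase), fun W hW => ⟨?_, ?_⟩⟩
  · intro G hG
    obtain ⟨i, -, rfl⟩ := (PMF.mem_support_map_iff _ _ _).1 hG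
    exact farFromBoundary_agentMatrix (pathRow_injOn hN hKm.le i) (pathColumn_injOn hN hKn i)
      hm9 hW
  · intro δ hδ tie Ω _ μ _ alg
    exact (ENNReal.ofReal_le_ofReal (exp_le_two_pow hKε)).trans
      (le_expected_iterations hε.1 hδ hK hKm.le hKn hbase hW tie μ alg)
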